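/- Let $M$ be a smooth (Hausdorff, second countable) manifold of dimension $d\ge 3$, $g$ a smooth semi-Riemannian metric on $M$ (of any signature) and $\Omega$ a smooth function on $M$ such that $d\Omega\neq 0$ at every point of $\mathscr J:=\{\Omega=0\}$. Let $$\lambda:=2\mathfrak s\,\Omega-|\nabla\Omega|_g^2,\qquad \mathfrak s:=\frac1d\Big(\square_g\Omega+\Omega\,\frac{\operatorname{Scal}_g}{2(d-1)}\Big),$$ and assume that $\lambda=0$ on $\mathscr J$ (in particular this holds if $\lambda\equiv 0$ on $M$). Let $\mathcal H\subset M$ be a smooth embedded hypersurface that is transverse to the generators of $\mathscr J$, i.e. the vector $\nabla\Omega$, which is null and tangent to $\mathscr J$, is not tangent to $\mathcal H$ at any point of $\mathscr J\cap\mathcal H$. Let $\omega_0$ be a smooth nowhere vanishing function on $\mathcal H$. Then there is an open neighbourhood $U$ of $\mathscr J\cap\mathcal H$ in $M$ and exactly one smooth nowhere vanishing function $\omega$ on $U$ such that $\widetilde g:=\omega^2 g$ and $\widetilde\Omega:=\omega\Omega$ satisfy $$|\widetilde\nabla\widetilde\Omega|^2_{\widetilde g}=0\ \text{ on } U,\qquad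 \widetilde\Omega=\omega_0\,\Omega\ \text{ on } \mathcal H\cap U .$$ Moreover, the solution does not depend on the neighbourhood: if $U'$ is another open neighbourhood of $\mathscr J\cap\mathcal H$ and $\omega'$ is a smooth nowhere vanishing function on $U'$ with the same two properties on $U'$, then $\omega'=\omega$ on some open neighbourhood $V\subset U\cap U'$ of $\mathscr J\cap\mathcal H$. -/

import Mathlib

open scoped Manifold ContDiff Topology

noncomputable section

namespace ConfGauge

/-- The model space `ℝ^d`. -/
abbrev Model (d : ℕ) : Type := EuclideanSpace ℝ (Fin d)

/-- A field of bilinear forms on the tangent spaces of a `d`-dimensional manifold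
(a covariant 2-tensor field, no smoothness imposed). -/
abbrev BilinField (d : ℕ) (M : Type*) [TopologicalSpace M] [ChartedSpace (Model d) M] : Type _ :=
  ∀ p : M, TangentSpace (𝓡 d) p →L[ℝ] TangentSpace (𝓡 d) p →L[ℝ] ℝ

section

variable {d : ℕ} {M : Type*} [TopologicalSpace M] [ChartedSpace (Model d) M]

/-- `g` is a smooth semi-Riemannian metric: a smooth, symmetric, everywhere nondegenerate
covariant 2-tensor field, of arbitrary signature. -/
structure IsSemiRiemannian [IsManifold (𝓡 d) ∞ M] (g : BilinField d M) : Prop where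
  symm : ∀ (p : M) (v w : TangentSpace (𝓡 d) p), g p v w = g p w v
  nondegenerate : ∀ (p : M) (v : TangentSpace (𝓡 d) p), (∀ w, g p v w = 0) → v = 0
  smooth : ContMDiff (𝓡 d) ((𝓡 d).prod 𝓘(ℝ, Model d →L[ℝ] Model d →L[ℝ] ℝ)) ∞
    (fun p ↦ Bundle.TotalSpace.mk' (Model d →L[ℝ] Model d →L[ℝ] ℝ)
      (E := fun q : M ↦ TangentSpace (𝓡 d) q →L[ℝ] TangentSpace (𝓡 d) q →L[ℝ] ℝ) p (g p))

/-- The differential `df` at `p`, as a covector. -/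
def differential (f : M → ℝ) (p : M) : TangentSpace (𝓡 d) p →L[ℝ] ℝ :=
  mfderiv (𝓡 d) 𝓘(ℝ, ℝ) f p

/-- The gradient of `f` with respect to `g` at `p`: the vector `v` with `g(v, ·) = df`
(for nondegenerate `g p`). -/
def grad (g : BilinField d M) (f : M → ℝ) (p : M) : TangentSpace (𝓡 d) p :=
  (g p).inverse (differential f p)

/-- `|∇f|²_g = g(∇f, ∇f)` at `p`. -/
def gradNormSq (g : BilinField d M) (f : M → ℝ) (p : M) : ℝ :=
  g p (grad g f p) (grad g f p)

/-- The conformal rescaling `w² g`. -/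
def rescale (w : M → ℝ) (g : BilinField d M) : BilinField d M :=
  fun p ↦ (w p ^ 2) • g p

/-! The scalar curvature and the d'Alembertian (Laplace-Beltrami operator), computed at a point
`p` in the preferred coordinate chart around `p`. -/

/-- The `i`-th coordinate direction of `ℝ^d`. -/
def coordVec (i : Fin d) : Model d := EuclideanSpace.single i 1

/-- The partial derivative `∂_i F` at `y` of a function on `ℝ^d`. -/
def partialDeriv (i : Fin d) (F : Model d → ℝ) (y : Model d) : ℝ := fderiv ℝ F y (coordVec i)

/-- The coordinate vector field `∂_i` of the chart around `p`, at the point with coordinates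
`y`. -/
def coordField (p : M) (i : Fin d) (y : Model d) :
    TangentSpace (𝓡 d) ((extChartAt (𝓡 d) p).symm y) :=
  mfderiv 𝓘(ℝ, Model d) (𝓡 d) (extChartAt (𝓡 d) p).symm y (coordVec i)

/-- The coordinate matrix `g_{ij}` in the chart around `p`. -/
def coordMetric (g : BilinField d M) (p : M) (y : Model d) : Matrix (Fin d) (Fin d) ℝ :=
  Matrix.of fun i j ↦ g ((extChartAt (𝓡 d) p).symm y) (coordField p i y) (coordField p j y)

/-- The Christoffel symbols `Γ^k_{ij} = ½ g^{kl} (∂_i g_{jl} + ∂_j g_{il} - ∂_l g_{ij})`. -/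
def christoffel (g : BilinField d M) (p : M) (k i j : Fin d) (y : Model d) : ℝ :=
  (1 / 2) * ∑ l, (coordMetric g p y)⁻¹ k l *
    (partialDeriv i (fun z ↦ coordMetric g p z j l) y
      + partialDeriv j (fun z ↦ coordMetric g p z i l) y
      - partialDeriv l (fun z ↦ coordMetric g p z i j) y)

/-- The coordinate components of the Ricci tensor,
`R_{ij} = ∂_k Γ^k_{ij} - ∂_j Γ^k_{ik} + Γ^k_{kl} Γ^l_{ij} - Γ^k_{jl} Γ^l_{ik}`. -/
def ricci (g : BilinField d M) (p : M) (i j : Fin d) (y : Model d) : ℝ :=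
  ∑ k, (partialDeriv k (christoffel g p k i j) y - partialDeriv j (christoffel g p k i k) y)
    + ∑ k, ∑ l, (christoffel g p k k l y * christoffel g p l i j y
      - christoffel g p k j l y * christoffel g p l i k y)

/-- The scalar curvature `g^{ij} R_{ij}` at `p`. -/
def scalarCurvature (g : BilinField d M) (p : M) : ℝ :=
  ∑ i, ∑ j, (coordMetric g p (extChartAt (𝓡 d) p p))⁻¹ i j * ricci g p i j (extChartAt (𝓡 d) p p)

/-- The d'Alembertian `□f = g^{ij} (∂_i ∂_j f - Γ^k_{ij} ∂_k f)` at `p`. -/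
def dAlembertian (g : BilinField d M) (f : M → ℝ) (p : M) : ℝ :=
  ∑ i, ∑ j, (coordMetric g p (extChartAt (𝓡 d) p p))⁻¹ i j *
    (partialDeriv i (partialDeriv j (fun z ↦ f ((extChartAt (𝓡 d) p).symm z)))
        (extChartAt (𝓡 d) p p)
      - ∑ k, christoffel g p k i j (extChartAt (𝓡 d) p p) *
        partialDeriv k (fun z ↦ f ((extChartAt (𝓡 d) p).symm z)) (extChartAt (𝓡 d) p p))

/-- The trace of the Schouten tensor, `L = Scal / (2 (d - 1))`. -/
def schoutenTrace (g : BilinField d M) (p : M) : ℝ :=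
  scalarCurvature g p / (2 * ((d : ℝ) - 1))

/-- The scalar `𝔰 = d⁻¹ (□Ω + Ω L)`. -/
def scalarS (g : BilinField d M) (Ω : M → ℝ) (p : M) : ℝ :=
  (d : ℝ)⁻¹ * (dAlembertian g Ω p + Ω p * schoutenTrace g p)

/-- `λ = 2 𝔰 Ω - |∇Ω|²_g`. -/
def lam (g : BilinField d M) (Ω : M → ℝ) (p : M) : ℝ :=
  2 * scalarS g Ω p * Ω p - gradNormSq g Ω p

/-- (Conformal) infinity `𝒥 = {Ω = 0}`. -/
def scri (Ω : M → ℝ) : Set M := {p | Ω p = 0}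

/-- `(M, g, Ω)` is a conformal manifold: `g` is a smooth semi-Riemannian metric and `Ω` is a
smooth function whose differential does not vanish at `𝒥 = {Ω = 0}`. -/
structure IsConformalManifold [IsManifold (𝓡 d) ∞ M] (g : BilinField d M) (Ω : M → ℝ) :
    Prop where
  metric : IsSemiRiemannian g
  smooth : ContMDiff (𝓡 d) 𝓘(ℝ, ℝ) ∞ Ω
  regular : ∀ p ∈ scri Ω, differential (d := d) Ω p ≠ 0

/-- `H` is a smooth (embedded) hypersurface: near each of its points it is the zero set of a
smooth function with nonvanishing differential there. -/
def IsHypersurface (d : ℕ) {M : Type*} [TopologicalSpace M] [ChartedSpace (Model d) M]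
    (H : Set M) : Prop :=
  ∀ p ∈ H, ∃ (U : Set M) (h : M → ℝ), IsOpen U ∧ p ∈ U ∧
    ContMDiffOn (𝓡 d) 𝓘(ℝ, ℝ) ∞ h U ∧ differential (d := d) h p ≠ 0 ∧
    ∀ q ∈ U, q ∈ H ↔ h q = 0

/-- `v` is tangent to `H` at `p`: it is annihilated by the differential of every smooth function
that is defined near `p` and vanishes on `H`. For a hypersurface with local defining function
`h` this says `dh(v) = 0`. -/
def IsTangentTo (H : Set M) (p : M) (v : TangentSpace (𝓡 d) p) : Prop :=
  ∀ (U : Set M) (h : M → ℝ), IsOpen U → p ∈ U → ContMDiffOn (𝓡 d) 𝓘(ℝ, ℝ) ∞ h U →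
    (∀ q ∈ U ∩ H, h q = 0) → differential h p v = 0

/-- `H` is transverse to the generators of `𝒥`: at no point of `H ∩ 𝒥` is the generator
`∇Ω` tangent to `H`. -/
def IsTransverseToScri (g : BilinField d M) (Ω : M → ℝ) (H : Set M) : Prop :=
  ∀ p ∈ H ∩ scri Ω, ¬ IsTangentTo H p (grad g Ω p)

/-- `φ` is a smooth function on `H`: near each point of `H` it is the restriction of a smooth
function on an open subset of the manifold. -/
def IsSmoothOnHypersurface (d : ℕ) {M : Type*} [TopologicalSpace M] [ChartedSpace (Model d) M]
    (H : Set M) (φ : H → ℝ) : Prop :=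
  ∀ p : H, ∃ (U : Set M) (F : M → ℝ), IsOpen U ∧ (p : M) ∈ U ∧
    ContMDiffOn (𝓡 d) 𝓘(ℝ, ℝ) ∞ F U ∧ ∀ q : H, (q : M) ∈ U → F q = φ q

/-- `w` is a smooth nowhere vanishing function on the open neighbourhood `U` of `𝒥 ∩ H` such
that `(g̃, Ω̃) = (w² g, w Ω)` satisfies `|∇̃Ω̃|²_g̃ = 0` on `U` and `Ω̃ = ω₀ Ω` on `H ∩ U`. -/
structure IsGauge (g : BilinField d M) (Ω : M → ℝ) (H : Set M) (ω₀ : H → ℝ)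
    (U : Set M) (w : M → ℝ) : Prop where
  isOpen : IsOpen U
  subset : scri Ω ∩ H ⊆ U
  smooth : ContMDiffOn (𝓡 d) 𝓘(ℝ, ℝ) ∞ w U
  ne_zero : ∀ p ∈ U, w p ≠ 0
  gradNormSq_eq_zero : ∀ p ∈ U, gradNormSq (rescale w g) (fun q ↦ w q * Ω q) p = 0
  initial : ∀ q : H, (q : M) ∈ U → w q * Ω q = ω₀ q * Ω q

end

end ConfGauge

end

open scoped Manifold ContDiff Topology

/-! Near a point of `𝒥 ∩ H`, extend `ω₀` to a smooth function `F`, replace `Ω` by `FΩ`, and look for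
a factor `ρ = exp u` with `u = 0` on `H = {h = 0}`. Expanding gives `|d(ρΩ)|² = ρ²|dΩ|² + Ω(2ρ
dρ(∇Ω) + Ω|dρ|²)`. The condition `λ = 0` on `𝒥` says that `|dΩ|²` vanishes there, so `|dΩ|² = Ω f`
with `f` smooth. One factor `Ω` cancels, leaving the Hamilton-Jacobi equation `f + 2 du(∇Ω) + Ω|du|²
= 0`. It is noncharacteristic for `H` because `dh(∇Ω) ≠ 0` on `𝒥 ∩ H`. The method of characteristics
solves it (`exists_hamiltonJacobi_solution`, `exists_local_gauge`). The smooth flow this needs comes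
from the inverse function theorem on a Banach space of curves (`exists_smooth_flow`).

For uniqueness (`exists_nhds_gauge_unique`), absorb one solution into `Ω`, so that `|dΩ|² = 0`. A
competitor is then a factor `ρ` with `2ρ dρ(∇Ω) + Ω|dρ|² = 0` and `ρ = 1` on `H`, hence `dρ = c dh`
there with `c (2 dh(∇Ω) + cΩ|dh|²) = 0`. The root `c ≠ 0` would need `cΩ` bounded away from zero,
which fails at `𝒥`. On a connected piece of `H` meeting `𝒥` this leaves only `c = 0`. Gronwall's
inequality carries `dρ = 0` along the integral curves of `∇Ω`, so `ρ = 1` on a flow box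
(`exists_flowBox`).

The local solutions are glued by `exists_compatible_nhds`. The final neighbourhood is a union of
small flow boxes, and uniqueness holds on each of them. -/

namespace ConfGauge

open Set Filter

/-! ### Inverse functions and smooth cut-offs -/

section Calculus

universe u

variable {E : Type*} [NormedAddCommGroup E] [NormedSpace ℝ E]
  {F : Type*} [NormedAddCommGroup F] [NormedSpace ℝ F]

/-- Inverse function theorem: near a point of invertible derivative, a smooth map restricts to an
open partial homeomorphism with smooth inverse. -/
theorem exists_openPartialHomeomorph_contDiffOn_symm [CompleteSpace E] {f : E → F} {s : Set E}
    (hs : IsOpen s) (hf : ContDiffOn ℝ ∞ f s) {a : E} (ha : a ∈ s) (f' : E ≃L[ℝ] F)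
    (hf' : HasFDerivAt f (f' : E →L[ℝ] F) a) :
    ∃ e : OpenPartialHomeomorph E F, (e : E → F) = f ∧ a ∈ e.source ∧ e.source ⊆ s ∧
      ContDiffOn ℝ ∞ e.symm e.target := by
  have hfa : ContDiffAt ℝ ∞ f a := hf.contDiffAt (hs.mem_nhds ha)
  let e₀ := hfa.toOpenPartialHomeomorph f hf' (by simp)
  have he₀ : (e₀ : E → F) = f := rfl
  -- The inverse is smooth on the whole target only if the derivative is invertible at every source
  -- point. Equivalences form an open set, so the source can be shrunk accordingly.
  have hcont : ContinuousOn (fderiv ℝ f) s := hf.continuousOn_fderiv_of_isOpen hs (by simp)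
  have hopen : IsOpen (s ∩ fderiv ℝ f ⁻¹' range ((↑) : (E ≃L[ℝ] F) → E →L[ℝ] F)) :=
    hcont.isOpen_inter_preimage hs ContinuousLinearEquiv.isOpen
  let e := e₀.restrOpen _ hopen
  have hsub : e.source ⊆ s ∩ fderiv ℝ f ⁻¹' range ((↑) : (E ≃L[ℝ] F) → E →L[ℝ] F) := by
    intro x hx
    rw [OpenPartialHomeomorph.restrOpen_source] at hx
    exact hx.2
  refine ⟨e, rfl, ?_, fun x hx => (hsub hx).1, ?_⟩
  · rw [OpenPartialHomeomorph.restrOpen_source]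
    exact ⟨hfa.mem_toOpenPartialHomeomorph_source hf' (by simp), ha, ⟨f', hf'.fderiv.symm⟩⟩
  · intro y hy
    have hx := hsub (e.map_target hy)
    obtain ⟨g', hg'⟩ := hx.2
    have hc : ContDiffAt ℝ ∞ f (e.symm y) := hf.contDiffAt (hs.mem_nhds hx.1)
    refine (e.contDiffAt_symm hy (f₀' := g') ?_ hc).contDiffWithinAt
    rw [hg']
    exact (hc.differentiableAt (by simp)).hasFDerivAt

/-- A function that is smooth near a point agrees near that point with a globally smooth one. -/
theorem exists_contDiff_eventuallyEq [FiniteDimensional ℝ E] {f : E → F} {s : Set E}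
    (hs : IsOpen s) (hf : ContDiffOn ℝ ∞ f s) {a : E} (ha : a ∈ s) :
    ∃ g : E → F, ContDiff ℝ ∞ g ∧ g =ᶠ[𝓝 a] f := by
  obtain ⟨r, hr, hrs⟩ := Metric.isOpen_iff.1 hs a ha
  -- The support lies in the closed ball of radius `r / 2`, inside `s`; off `s` the product is
  -- therefore locally zero.
  let b : ContDiffBump a := ⟨r / 4, r / 2, by positivity, by linarith⟩
  refine ⟨fun x => b x • f x, ?_, ?_⟩
  · rw [contDiff_iff_contDiffAt]
    intro x
    by_cases hx : x ∈ s
    · exact b.contDiff.contDiffAt.smul (hf.contDiffAt (hs.mem_nhds hx))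
    · have hx' : x ∉ tsupport b := by
        rw [b.tsupport_eq]
        exact fun h => hx (hrs (Metric.closedBall_subset_ball (by change r / 2 < r; linarith) h))
      have h0 : (fun x => b x • f x) =ᶠ[𝓝 x] fun _ => 0 := by
        filter_upwards [notMem_tsupport_iff_eventuallyEq.1 hx'] with y hy
        simp [hy]
      exact contDiffAt_const.congr_of_eventuallyEq h0
  · filter_upwards [b.eventuallyEq_one] with x hx
    simp [hx]

end Calculus

/-! ### Smoothness of `η ↦ f ∘ η` on spaces of continuous maps -/

section Superposition

variable {K : Type*} [TopologicalSpace K] [CompactSpace K]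

variable {E : Type*} [NormedAddCommGroup E] [NormedSpace ℝ E]
  {F : Type*} [NormedAddCommGroup F] [NormedSpace ℝ F]
  {G : Type*} [NormedAddCommGroup G] [NormedSpace ℝ G]

variable (K) in
/-- Pointwise application of a continuous bilinear map to continuous maps. -/
noncomputable def pointwiseApply (B : G →L[ℝ] E →L[ℝ] F) :
    C(K, G) →L[ℝ] C(K, E) →L[ℝ] C(K, F) :=
  LinearMap.mkContinuous₂
    (LinearMap.mk₂ ℝ (fun (φ : C(K, G)) (η : C(K, E)) =>
        (⟨fun t => B (φ t) (η t), by fun_prop⟩ : C(K, F)))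
      (fun _ _ _ => by ext; simp) (fun _ _ _ => by ext; simp)
      (fun _ _ _ => by ext; simp) (fun _ _ _ => by ext; simp)) ‖B‖
    (fun φ η => by
      rw [ContinuousMap.norm_le _ (by positivity)]
      intro t
      refine (B.le_opNorm₂ _ _).trans ?_
      gcongr
      · exact φ.norm_coe_le_norm t
      · exact η.norm_coe_le_norm t)

theorem contDiff_pointwiseApply {n : WithTop ℕ∞} (B : G →L[ℝ] E →L[ℝ] F)
    {N : C(K, E) → C(K, G)} (hN : ContDiff ℝ n N) :
    ContDiff ℝ n fun η => pointwiseApply K B (N η) :=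
  (pointwiseApply K B).contDiff.comp hN

/-- Continuity of `η ↦ f' ∘ η` in the supremum norm makes the modulus of continuity of `f'` along
`γ` uniform in `t`; the mean value inequality then bounds the remainder uniformly. -/
theorem hasFDerivAt_comp_continuousMap (f : C(E, F)) (f' : C(E, E →L[ℝ] F))
    (hf : ∀ x, HasFDerivAt f (f' x) x) (γ : C(K, E)) :
    HasFDerivAt (fun η : C(K, E) => f.comp η) (pointwiseApply K (ContinuousLinearMap.id ℝ (E →L[ℝ] F)) (f'.comp γ)) γ := by
  rw [hasFDerivAt_iff_isLittleO_nhds_zero, Asymptotics.isLittleO_iff]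
  intro c hc
  have hcont : ContinuousAt (fun η : C(K, E) => f'.comp η) γ :=
    (ContinuousMap.continuous_postcomp f').continuousAt
  obtain ⟨δ, hδ, H⟩ := (Metric.continuousAt_iff (α := C(K, E)) (β := C(K, E →L[ℝ] F))).1 hcont c hc
  filter_upwards [Metric.ball_mem_nhds (0 : C(K, E)) hδ] with h hh
  rw [mem_ball_zero_iff] at hh
  rw [ContinuousMap.norm_le _ (by positivity)]
  intro t
  have key : ∀ z ∈ Metric.closedBall (γ t) ‖h‖, ‖f' z - f' (γ t)‖ ≤ c := by
    intro z hz
    -- Shifting the whole curve by a constant turns the estimate in `C(K, E)` into one at the single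
    -- point `z`.
    let η : C(K, E) := γ + ContinuousMap.const K (z - γ t)
    have h1 : dist η γ < δ := by
      rw [dist_eq_norm]
      refine lt_of_le_of_lt ?_ hh
      rw [ContinuousMap.norm_le _ (norm_nonneg _)]
      intro s
      simpa [η, dist_eq_norm] using hz
    have h2 := (ContinuousMap.dist_apply_le_dist t).trans (H h1).le
    simpa [η, dist_eq_norm] using h2
  have := (convex_closedBall (γ t) ‖h‖).norm_image_sub_le_of_norm_hasFDerivWithin_le'
    (fun z _ => (hf z).hasFDerivWithinAt) key (Metric.mem_closedBall_self (norm_nonneg _))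
    (y := γ t + h t) (by simpa using h.norm_coe_le_norm t)
  simp only [add_sub_cancel_left] at this
  exact this.trans (mul_le_mul_of_nonneg_left (h.norm_coe_le_norm t) hc.le)

end Superposition

section Superposition

universe u
variable {K : Type*} [TopologicalSpace K] [CompactSpace K]
  {E : Type u} [NormedAddCommGroup E] [NormedSpace ℝ E]

/-- The codomain varies in the induction because the derivative of `f` has values in `E →L[ℝ] F`;
the common universe keeps this space within reach of the induction hypothesis. -/
theorem contDiff_nat_comp_continuousMap (n : ℕ) : ∀ {F : Type u} [NormedAddCommGroup F]
    [NormedSpace ℝ F] (f : C(E, F)), ContDiff ℝ n f →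
    ContDiff ℝ n (fun η : C(K, E) => f.comp η) := by
  induction n with
  | zero =>
    intro F _ _ f _
    exact contDiff_zero.2 (ContinuousMap.continuous_postcomp f)
  | succ n ih =>
    intro F _ _ f hf
    push_cast at hf ⊢
    obtain ⟨f', hf', hd⟩ := contDiff_succ_iff_hasFDerivAt.1 hf
    rw [contDiff_succ_iff_hasFDerivAt]
    exact ⟨fun η => pointwiseApply K (ContinuousLinearMap.id ℝ (E →L[ℝ] F)) ((⟨f', hf'.continuous⟩ : C(E, E →L[ℝ] F)).comp η),
      contDiff_pointwiseApply _ (ih (⟨f', hf'.continuous⟩ : C(E, E →L[ℝ] F)) hf'),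
      fun η => hasFDerivAt_comp_continuousMap f ⟨f', hf'.continuous⟩ hd η⟩

/-- Superposition by a smooth map is smooth on spaces of continuous maps. -/
theorem contDiff_comp_continuousMap {F : Type u} [NormedAddCommGroup F] [NormedSpace ℝ F]
    (f : C(E, F)) (hf : ContDiff ℝ ∞ f) : ContDiff ℝ ∞ (fun η : C(K, E) => f.comp η) :=
  contDiff_infty.2 fun n => contDiff_nat_comp_continuousMap n f (contDiff_infty.1 hf n)

end Superposition

/-! ### Smooth local flows via the Picard map -/

section Flow

universe u

/-- The compact time interval `[-1, 1]`. -/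
abbrev TimeInterval : Type := Icc (-1 : ℝ) 1

theorem TimeInterval.abs_le (s : TimeInterval) : |(s : ℝ)| ≤ 1 := _root_.abs_le.2 ⟨s.2.1, s.2.2⟩

/-- The projection of the real line onto `[-1, 1]`. -/
noncomputable def toTime (t : ℝ) : TimeInterval := projIcc (-1) 1 (by norm_num) t

@[fun_prop] theorem continuous_toTime : Continuous toTime :=
  continuous_projIcc (h := by norm_num)

theorem toTime_of_abs_le {t : ℝ} (h : |t| ≤ 1) : toTime t = ⟨t, _root_.abs_le.1 h⟩ :=
  projIcc_of_mem _ _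

variable {E : Type u} [NormedAddCommGroup E] [NormedSpace ℝ E]

/-- Linear reparametrization of time by a factor in `[-1, 1]`. -/
def scaleTime (s : TimeInterval) : C(TimeInterval, TimeInterval) where
  toFun r := ⟨s * r, _root_.abs_le.1 (by
    rw [abs_mul]; exact mul_le_one₀ s.abs_le (abs_nonneg _) r.abs_le)⟩
  continuous_toFun := by fun_prop

variable (E) in
/-- The integration operator `φ ↦ ∫₀ φ` on continuous curves. -/
noncomputable def primitive : C(TimeInterval, E) →L[ℝ] C(TimeInterval, E) :=
  LinearMap.mkContinuous
    { toFun := fun φ => ⟨fun s => ∫ q in (0 : ℝ)..s, φ (toTime q),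
        (intervalIntegral.continuous_primitive
          (fun _ _ => (show Continuous fun q => φ (toTime q) by fun_prop).intervalIntegrable _ _)
          0).comp continuous_subtype_val⟩
      map_add' := fun φ ψ => by
        ext s
        exact intervalIntegral.integral_add
          ((show Continuous fun q => φ (toTime q) by fun_prop).intervalIntegrable _ _)
          ((show Continuous fun q => ψ (toTime q) by fun_prop).intervalIntegrable _ _)
      map_smul' := fun c φ => by
        ext s
        exact intervalIntegral.integral_smul c _ } 1
    (fun φ => by
      rw [one_mul, ContinuousMap.norm_le _ (norm_nonneg φ)]
      intro s
      refine (intervalIntegral.norm_integral_le_of_norm_le_const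
        (C := ‖φ‖) fun q _ => φ.norm_coe_le_norm _).trans ?_
      rw [sub_zero]
      exact mul_le_of_le_one_right (norm_nonneg _) s.abs_le)

theorem primitive_apply (φ : C(TimeInterval, E)) (s : TimeInterval) :
    primitive E φ s = ∫ q in (0 : ℝ)..s, φ (toTime q) := rfl

/-- Substitution `q ↦ s q`. It shows that a time-rescaled solution of the Picard equation with
parameter `t` solves it with parameter `s t`. -/
theorem primitive_scaleTime (φ : C(TimeInterval, E)) (s r : TimeInterval) :
    primitive E φ (scaleTime s r) = (s : ℝ) • primitive E (φ.comp (scaleTime s)) r := by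
  simp only [primitive_apply]
  have : ∫ q in (0 : ℝ)..r, (φ.comp (scaleTime s)) (toTime q)
      = ∫ q in (0 : ℝ)..r, φ (toTime ((s : ℝ) * q)) := by
    refine intervalIntegral.integral_congr fun q hq => ?_
    have hq' : |q| ≤ 1 := by
      have := abs_sub_left_of_mem_uIcc hq
      simp only [sub_zero] at this
      exact this.trans r.abs_le
    have hsq : |(s : ℝ) * q| ≤ 1 := by
      rw [abs_mul]; exact mul_le_one₀ s.abs_le (abs_nonneg _) hq'
    simp only [toTime_of_abs_le hq', toTime_of_abs_le hsq, ContinuousMap.comp_apply]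
    rfl
  rw [this, intervalIntegral.smul_integral_comp_mul_left (fun q => φ (toTime q)), mul_zero]
  rfl

variable (E) in
/-- Constant curves, as a continuous linear map. -/
noncomputable def constCurve : E →L[ℝ] C(TimeInterval, E) :=
  LinearMap.mkContinuous
    { toFun := fun x => ContinuousMap.const _ x
      map_add' := fun _ _ => rfl
      map_smul' := fun _ _ => rfl } 1
    (fun x => by
      rw [one_mul, ContinuousMap.norm_le _ (norm_nonneg x)]
      intro s
      exact le_rfl)

@[simp] theorem constCurve_apply (x : E) (s : TimeInterval) : constCurve E x s = x := rfl

/-- The triangular map `(p, γ) ↦ (p, γ - x - ε c)` with `p = (ε, x)`. -/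
noncomputable def picardEquiv (c : C(TimeInterval, E)) :
    ((ℝ × E) × C(TimeInterval, E)) ≃L[ℝ] ((ℝ × E) × C(TimeInterval, E)) :=
  ContinuousLinearEquiv.equivOfInverse
    ((ContinuousLinearMap.fst ℝ _ _).prod (ContinuousLinearMap.snd ℝ _ _
      - constCurve E ∘L ContinuousLinearMap.snd ℝ _ _ ∘L ContinuousLinearMap.fst ℝ _ _
      - (ContinuousLinearMap.fst ℝ _ _ ∘L ContinuousLinearMap.fst ℝ _ _).smulRight c))
    ((ContinuousLinearMap.fst ℝ _ _).prod (ContinuousLinearMap.snd ℝ _ _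
      + constCurve E ∘L ContinuousLinearMap.snd ℝ _ _ ∘L ContinuousLinearMap.fst ℝ _ _
      + (ContinuousLinearMap.fst ℝ _ _ ∘L ContinuousLinearMap.fst ℝ _ _).smulRight c))
    (fun p => by ext <;> simp <;> abel) (fun p => by ext <;> simp <;> abel)

/-- The Picard map `(ε, x, γ) ↦ (ε, x, γ - x - ε ∫₀ f ∘ γ)`. -/
noncomputable def picardMap (f : C(E, E)) (p : (ℝ × E) × C(TimeInterval, E)) :
    (ℝ × E) × C(TimeInterval, E) :=
  (p.1, p.2 - constCurve E p.1.2 - p.1.1 • primitive E (f.comp p.2))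

theorem contDiff_picardMap (f : C(E, E)) (hf : ContDiff ℝ ∞ f) : ContDiff ℝ ∞ (picardMap f) := by
  have h1 : ContDiff ℝ ∞ fun p : (ℝ × E) × C(TimeInterval, E) => primitive E (f.comp p.2) :=
    (primitive E).contDiff.comp ((contDiff_comp_continuousMap f hf).comp contDiff_snd)
  have h2 : ContDiff ℝ ∞ fun p : (ℝ × E) × C(TimeInterval, E) => constCurve E p.1.2 :=
    (constCurve E).contDiff.comp (contDiff_snd.comp contDiff_fst)
  exact contDiff_fst.prodMk ((contDiff_snd.sub h2).sub ((contDiff_fst.comp contDiff_fst).smul h1))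

/-- At `ε = 0` the nonlinear term enters the derivative only through the variation of `ε`, so the
derivative is triangular, hence invertible, whatever `f` is. -/
theorem hasFDerivAt_picardMap (f : C(E, E)) (hf : ContDiff ℝ ∞ f) (x : E)
    (γ : C(TimeInterval, E)) :
    HasFDerivAt (picardMap f) (picardEquiv (primitive E (f.comp γ)) :
      ((ℝ × E) × C(TimeInterval, E)) →L[ℝ] ((ℝ × E) × C(TimeInterval, E))) ((0, x), γ) := by
  have h1 : HasFDerivAt (fun p : (ℝ × E) × C(TimeInterval, E) => primitive E (f.comp p.2))
      (fderiv ℝ (fun p : (ℝ × E) × C(TimeInterval, E) => primitive E (f.comp p.2)) ((0, x), γ))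
      ((0, x), γ) := by
    have : ContDiff ℝ ∞ fun p : (ℝ × E) × C(TimeInterval, E) => primitive E (f.comp p.2) :=
      (primitive E).contDiff.comp ((contDiff_comp_continuousMap f hf).comp contDiff_snd)
    exact (this.differentiable (by simp) _).hasFDerivAt
  have h2 : HasFDerivAt (fun p : (ℝ × E) × C(TimeInterval, E) => constCurve E p.1.2)
      (constCurve E ∘L ContinuousLinearMap.snd ℝ _ _ ∘L ContinuousLinearMap.fst ℝ _ _)
      ((0, x), γ) :=
    (constCurve E).hasFDerivAt.comp (f := fun p : (ℝ × E) × C(TimeInterval, E) => p.1.2) _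
      (hasFDerivAt_snd.comp _ hasFDerivAt_fst)
  have h3 : HasFDerivAt (fun p : (ℝ × E) × C(TimeInterval, E) => p.1.1)
      (ContinuousLinearMap.fst ℝ _ _ ∘L ContinuousLinearMap.fst ℝ _ _) ((0, x), γ) :=
    hasFDerivAt_fst.comp _ hasFDerivAt_fst
  have h := (hasFDerivAt_fst (𝕜 := ℝ) (p := (((0 : ℝ), x), γ))).prodMk
    ((hasFDerivAt_snd.sub h2).sub (h3.smul h1))
  refine h.congr_fderiv ?_
  ext p <;> simp [picardEquiv]

/-- Smooth local flow of a smooth vector field. -/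
theorem exists_smooth_flow [CompleteSpace E] {f : E → E} (hf : ContDiff ℝ ∞ f) (x₀ : E) :
    ∃ r > 0, ∃ Φ : ℝ × E → E, ContDiffOn ℝ ∞ Φ (Metric.ball 0 r ×ˢ Metric.ball x₀ r) ∧
      (∀ x ∈ Metric.ball x₀ r, Φ (0, x) = x) ∧
      ∀ t ∈ Metric.ball (0 : ℝ) r, ∀ x ∈ Metric.ball x₀ r,
        HasDerivAt (fun s => Φ (s, x)) (f (Φ (t, x))) t := by
  let fc : C(E, E) := ⟨f, hf.continuous⟩
  have hfc : ContDiff ℝ ∞ fc := hf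
  let a : (ℝ × E) × C(TimeInterval, E) := ((0, x₀), constCurve E x₀)
  obtain ⟨e, he, hae, -, hsymm⟩ := exists_openPartialHomeomorph_contDiffOn_symm isOpen_univ
    (contDiff_picardMap fc hfc).contDiffOn (mem_univ a) _
    (hasFDerivAt_picardMap fc hfc x₀ (constCurve E x₀))
  have hea : e a = ((0, x₀), 0) := by
    rw [he]; ext <;> simp [a, picardMap]
  obtain ⟨δ, hδ, hδs⟩ := Metric.isOpen_iff.1 e.open_source a hae
  let ι : ℝ × E → (ℝ × E) × C(TimeInterval, E) := fun p => (p, 0)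
  have hι : ContDiff ℝ ∞ ι := contDiff_id.prodMk contDiff_const
  -- `γ (t, x)` is the orbit of `x` with time rescaled to `[-1, 1]`: its value at `s` will be the
  -- flow at time `t s`.
  let γ : ℝ × E → C(TimeInterval, E) := fun p => (e.symm (ι p)).2
  have hmem : ι (0, x₀) ∈ e.target := by
    have := e.map_source hae
    rwa [hea] at this
  have hγ0 : γ (0, x₀) = constCurve E x₀ := by
    have : e.symm (ι (0, x₀)) = a := by
      have h : ι (0, x₀) = e a := hea.symm
      rw [h, e.left_inv hae]
    change (e.symm (ι (0, x₀))).2 = _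
    rw [this]
  have hγsm : ContDiffOn ℝ ∞ γ (ι ⁻¹' e.target) :=
    contDiff_snd.comp_contDiffOn (hsymm.comp hι.contDiffOn (fun _ h => h))
  have hopen : IsOpen (ι ⁻¹' e.target) := e.open_target.preimage hι.continuous
  have hγc : ContinuousAt γ (0, x₀) :=
    (hγsm.contDiffAt (hopen.mem_nhds hmem)).continuousAt
  have hnear : ∀ᶠ p in 𝓝 ((0 : ℝ), x₀), p ∈ ι ⁻¹' e.target ∧
      γ p ∈ Metric.ball (constCurve E x₀) δ := by
    refine Filter.Eventually.and (hopen.mem_nhds hmem) ?_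
    exact hγc (by rw [hγ0]; exact Metric.ball_mem_nhds _ hδ)
  obtain ⟨r₀, hr₀, hr₀s⟩ := Metric.eventually_nhds_iff_ball.1 hnear
  -- `r₀` keeps the parameters in the target and the curve near the constant one; `δ` keeps rescaled
  -- triples in the source of `e`.
  let r := min r₀ δ
  have hr : 0 < r := lt_min hr₀ hδ
  have hrmem : ∀ {t : ℝ} {x : E}, t ∈ Metric.ball (0 : ℝ) r → x ∈ Metric.ball x₀ r →
      (t, x) ∈ Metric.ball ((0 : ℝ), x₀) r₀ := by
    intro t x ht hx
    rw [← ball_prod_same]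
    exact ⟨Metric.ball_subset_ball (min_le_left _ _) ht,
      Metric.ball_subset_ball (min_le_left _ _) hx⟩
  -- the fixed point equation
  have hfix : ∀ {t : ℝ} {x : E}, t ∈ Metric.ball (0 : ℝ) r → x ∈ Metric.ball x₀ r →
      γ (t, x) = constCurve E x + t • primitive E (fc.comp (γ (t, x))) := by
    intro t x ht hx
    have h1 := e.right_inv (hr₀s _ (hrmem ht hx)).1
    rw [he] at h1
    have h2 := congrArg Prod.fst h1
    have h3 := congrArg Prod.snd h1
    simp only [picardMap, ι] at h2 h3
    rw [h2] at h3
    rw [sub_sub, sub_eq_zero] at h3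
    exact h3
  -- Both curves solve the Picard equation with parameter `s t`. The rescaled one also lies in the
  -- source of `e`, so injectivity of `e` identifies them.
  have hscale : ∀ {t : ℝ} {x : E} (s : TimeInterval), t ∈ Metric.ball (0 : ℝ) r →
      x ∈ Metric.ball x₀ r → γ (s * t, x) = (γ (t, x)).comp (scaleTime s) := by
    intro t x s ht hx
    have ht' : |t| < r := by simpa using ht
    have hst : |(s : ℝ) * t| < r := by
      rw [abs_mul]
      exact lt_of_le_of_lt (mul_le_of_le_one_left (abs_nonneg _) s.abs_le) ht'
    set η := (γ (t, x)).comp (scaleTime s) with hη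
    have hsrc : (((s : ℝ) * t, x), η) ∈ e.source := by
      apply hδs
      rw [← ball_prod_same, ← ball_prod_same]
      refine ⟨⟨?_, Metric.ball_subset_ball (min_le_right _ _) hx⟩, ?_⟩
      · simpa using lt_of_lt_of_le hst (min_le_right _ _)
      · rw [Metric.mem_ball]
        refine lt_of_le_of_lt ?_ (hr₀s _ (hrmem ht hx)).2
        rw [ContinuousMap.dist_le dist_nonneg]
        intro q
        exact ContinuousMap.dist_apply_le_dist (f := γ (t, x)) (g := constCurve E x₀)
          (scaleTime s q)
    have himg : e (((s : ℝ) * t, x), η) = ι (s * t, x) := by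
      rw [he]
      refine Prod.ext rfl ?_
      change η - constCurve E x - ((s : ℝ) * t) • primitive E (fc.comp η) = 0
      rw [sub_sub, sub_eq_zero]
      ext q
      have h := congrArg (fun φ : C(TimeInterval, E) => φ (scaleTime s q)) (hfix ht hx)
      simp only [ContinuousMap.add_apply, ContinuousMap.smul_apply, constCurve_apply,
        primitive_scaleTime] at h
      rw [hη, ContinuousMap.comp_apply, h, ContinuousMap.add_apply, ContinuousMap.smul_apply,
        constCurve_apply, smul_smul, mul_comm t]
      rfl
    change (e.symm (ι (s * t, x))).2 = η
    rw [← himg, e.left_inv hsrc]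
  let one : TimeInterval := ⟨1, by norm_num⟩
  refine ⟨r, hr, fun p => γ p one, ?_, ?_, ?_⟩
  · refine ((ContinuousMap.evalCLM ℝ one : C(TimeInterval, E) →L[ℝ] E).contDiff.comp_contDiffOn hγsm).mono ?_
    rintro ⟨t, x⟩ ⟨ht, hx⟩
    exact (hr₀s _ (hrmem ht hx)).1
  · intro x hx
    change γ (0, x) one = x
    rw [hfix (Metric.mem_ball_self hr) hx]
    simp
  · intro t ht x hx
    have ht' : |t| < r := by simpa using ht
    -- A single curve `γ (ε, x)` with `|t| < ε < r` covers all times near `t`, so the flow there is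
    -- a primitive in the time variable.
    obtain ⟨ε, hε1, hε2⟩ := exists_between ht'
    have hε0 : 0 < ε := (abs_nonneg t).trans_lt hε1
    have hεr : ε ∈ Metric.ball (0 : ℝ) r := by simpa [abs_of_pos hε0] using hε2
    have hval : ∀ s : ℝ, |s| < ε → γ (s, x) one = γ (ε, x) (toTime (s / ε)) := by
      intro s hs
      have hs1 : |s / ε| ≤ 1 := by
        rw [abs_div, abs_of_pos hε0, div_le_one hε0]; exact hs.le
      have := hscale (t := ε) (x := x) (toTime (s / ε)) hεr hx
      rw [toTime_of_abs_le hs1] at this ⊢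
      simp only [div_mul_cancel₀ _ hε0.ne'] at this
      rw [this, ContinuousMap.comp_apply]
      congr 1
      exact Subtype.ext (mul_one _)
    have hint : ∀ s : ℝ, |s| < ε → γ (s, x) one =
        x + ε • ∫ q in (0 : ℝ)..(s / ε), f (γ (ε, x) (toTime q)) := by
      intro s hs
      have hs1 : |s / ε| ≤ 1 := by
        rw [abs_div, abs_of_pos hε0, div_le_one hε0]; exact hs.le
      rw [hval s hs, hfix hεr hx, ContinuousMap.add_apply, ContinuousMap.smul_apply,
        constCurve_apply, primitive_apply, ← hfix hεr hx, toTime_of_abs_le hs1]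
      rfl
    have hev : (fun s => γ (s, x) one) =ᶠ[𝓝 t]
        fun s => x + ε • ∫ q in (0 : ℝ)..(s / ε), f (γ (ε, x) (toTime q)) := by
      have : ∀ᶠ s : ℝ in 𝓝 t, |s| < ε := continuous_abs.continuousAt.eventually_lt_const hε1
      filter_upwards [this] with s hs using hint s hs
    refine HasDerivAt.congr_of_eventuallyEq ?_ hev
    have hcont : Continuous fun q => f (γ (ε, x) (toTime q)) :=
      hf.continuous.comp ((γ (ε, x)).continuous.comp continuous_toTime)
    have hd := (hcont.integral_hasStrictDerivAt 0 (t / ε)).hasDerivAt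
    have hd2 := HasDerivAt.scomp t hd ((hasDerivAt_id t).div_const ε)
    have hd3 := (hd2.const_smul ε).const_add x
    convert! hd3 using 1
    change f (γ (t, x) one) = _
    rw [hval t hε1, smul_smul, mul_one_div_cancel hε0.ne', one_smul]

end Flow

/-! ### Straightening a hypersurface, and division by its defining function -/

section Straightening

variable {E : Type} [NormedAddCommGroup E] [NormedSpace ℝ E]

/-- Near a zero with nonvanishing differential, a smooth function becomes affine in suitable
smooth coordinates. -/
theorem exists_straightening [CompleteSpace E] {h : E → ℝ} (hh : ContDiff ℝ ∞ h) {y : E}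
    (hy : h y = 0) (hd : fderiv ℝ h y ≠ 0) :
    ∃ a : E, fderiv ℝ h y a = 1 ∧ ∃ e : OpenPartialHomeomorph E E, y ∈ e.source ∧ e y = y ∧
      ContDiff ℝ ∞ e ∧ ContDiffOn ℝ ∞ e.symm e.target ∧ ∀ x, fderiv ℝ h y (e x - y) = h x := by
  obtain ⟨a₀, ha₀⟩ : ∃ a, fderiv ℝ h y a ≠ 0 := by
    by_contra! hcon
    exact hd (ContinuousLinearMap.ext hcon)
  let a := (fderiv ℝ h y a₀)⁻¹ • a₀
  have ha : fderiv ℝ h y a = 1 := by simp [a, ha₀]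
  -- Moving `x` along `a` by the nonlinear part of `h` makes the linear part of `h` at `ψ x` equal
  -- to `h x`. The correction is of second order, so the derivative at `y` is the identity.
  let ψ : E → E := fun x => x + (h x - fderiv ℝ h y (x - y)) • a
  have hψ : ContDiff ℝ ∞ ψ := by
    have h1 : ContDiff ℝ ∞ fun x => fderiv ℝ h y (x - y) :=
      (fderiv ℝ h y).contDiff.comp (contDiff_id.sub contDiff_const)
    exact contDiff_id.add ((hh.sub h1).smul contDiff_const)
  have hψd : HasFDerivAt ψ ((ContinuousLinearEquiv.refl ℝ E : E ≃L[ℝ] E) : E →L[ℝ] E) y := by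
    have h1 : HasFDerivAt (fun x => fderiv ℝ h y (x - y)) (fderiv ℝ h y) y :=
      (fderiv ℝ h y).hasFDerivAt.comp (f := fun x => x - y) y ((hasFDerivAt_id y).sub_const y)
    have h2 := ((hh.differentiable (by simp) y).hasFDerivAt.sub h1).smul_const a
    refine ((hasFDerivAt_id y).add h2).congr_fderiv ?_
    ext; simp
  obtain ⟨e, he, hye, -, hs⟩ := exists_openPartialHomeomorph_contDiffOn_symm isOpen_univ
    hψ.contDiffOn (mem_univ y) _ hψd
  refine ⟨a, ha, e, hye, ?_, he ▸ hψ, hs, fun x => ?_⟩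
  · rw [he]; simp [ψ, hy]
  · rw [he]
    simp only [ψ, map_sub, map_add, map_smul, ha, smul_eq_mul]
    ring

/-- A zero set with nonvanishing differential has arbitrarily small connected pieces. -/
theorem exists_isOpen_isPreconnected_inter_zero [CompleteSpace E] {h : E → ℝ}
    (hh : ContDiff ℝ ∞ h) {y : E} (hy : h y = 0) (hd : fderiv ℝ h y ≠ 0) {V : Set E}
    (hV : V ∈ 𝓝 y) :
    ∃ D : Set E, IsOpen D ∧ y ∈ D ∧ D ⊆ V ∧ IsPreconnected (D ∩ {x | h x = 0}) := by
  obtain ⟨a, -, e, hye, hey, -, hs, he⟩ := exists_straightening hh hy hd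
  have hyt : y ∈ e.target := hey ▸ e.map_source hye
  have hsymy : e.symm y = y := by
    conv_lhs => rw [← hey]
    exact e.left_inv hye
  have hnhds : e.target ∩ e.symm ⁻¹' V ∈ 𝓝 y := by
    refine inter_mem (e.open_target.mem_nhds hyt) ?_
    exact (e.continuousAt_symm hyt).preimage_mem_nhds (by rwa [hsymy])
  obtain ⟨r, hr, hrs⟩ := Metric.mem_nhds_iff.1 hnhds
  refine ⟨e.source ∩ e ⁻¹' Metric.ball y r, e.isOpen_inter_preimage Metric.isOpen_ball,
    ⟨hye, by simpa [hey] using hr⟩, ?_, ?_⟩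
  · rintro x ⟨hx, hxr⟩
    have := (hrs hxr).2
    rwa [mem_preimage, e.left_inv hx] at this
  -- In straightened coordinates the zero set in the ball is a ball cut by a hyperplane, which is
  -- convex.
  · have heq : e.source ∩ e ⁻¹' Metric.ball y r ∩ {x | h x = 0} =
        e.symm '' (Metric.ball y r ∩ {z | fderiv ℝ h y z = fderiv ℝ h y y}) := by
      ext x
      constructor
      · rintro ⟨⟨hx, hxr⟩, hx0⟩
        refine ⟨e x, ⟨hxr, ?_⟩, e.left_inv hx⟩
        have := he x
        rw [map_sub, show h x = 0 from hx0, sub_eq_zero] at this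
        exact this
      · rintro ⟨z, ⟨hz, hz0⟩, rfl⟩
        have hzt := (hrs hz).1
        refine ⟨⟨e.map_target hzt, ?_⟩, ?_⟩
        · rw [mem_preimage, e.right_inv hzt]; exact hz
        · have := he (e.symm z)
          rw [e.right_inv hzt, map_sub, show fderiv ℝ h y z = fderiv ℝ h y y from hz0,
            sub_self] at this
          exact this.symm
    rw [heq]
    refine IsPreconnected.image (Convex.isPreconnected ?_) _
      (e.continuousOn_symm.mono fun z hz => (hrs hz.1).1)
    exact (convex_ball y r).inter (convex_hyperplane (fderiv ℝ h y).toLinearMap.isLinear _)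

/-- A smooth function vanishing on the zero set of `h` is divisible by `h`. -/
theorem exists_eq_mul_of_vanishes [FiniteDimensional ℝ E] {h : E → ℝ} (hh : ContDiff ℝ ∞ h)
    {y : E} (hy : h y = 0) (hd : fderiv ℝ h y ≠ 0) {G : E → ℝ} (hG : ContDiff ℝ ∞ G)
    (hv : ∀ᶠ x in 𝓝 y, h x = 0 → G x = 0) :
    ∃ k : E → ℝ, ContDiff ℝ ∞ k ∧ ∀ᶠ x in 𝓝 y, G x = h x * k x := by
  have := FiniteDimensional.complete ℝ E
  obtain ⟨a, ha, e, hye, hey, hes, hs, he⟩ := exists_straightening hh hy hd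
  have hyt : y ∈ e.target := hey ▸ e.map_source hye
  have hsymy : e.symm y = y := by
    conv_lhs => rw [← hey]
    exact e.left_inv hye
  obtain ⟨G₁, hG₁, hG₁e⟩ := exists_contDiff_eventuallyEq e.open_target
    (hG.comp_contDiffOn hs) hyt
  have hG₁d : ContDiff ℝ ∞ fun z => fderiv ℝ G₁ z a :=
    (hG₁.fderiv_right (m := ∞) (by simp)).clm_apply contDiff_const
  let g : C(E, ℝ) := ⟨fun z => fderiv ℝ G₁ z a, hG₁d.continuous⟩
  let l : E → ℝ := fun z => fderiv ℝ h y (z - y)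
  have hl : ContDiff ℝ ∞ l := (fderiv ℝ h y).contDiff.comp (contDiff_id.sub contDiff_const)
  let lin : C(TimeInterval, E) := ⟨fun s => (s : ℝ) • a, by fun_prop⟩
  -- Hadamard's lemma: on `[0, 1]` the curve `c z` runs from the projection of `z` to the hyperplane
  -- `l = 0` along `a` up to `z`. The quotient `k` is the integral of the derivative along `a` over
  -- it, smooth in `z` by superposition.
  let c : E → C(TimeInterval, E) := fun z => constCurve E (z - l z • a) + l z • lin
  have hc : ContDiff ℝ ∞ c :=
    ((constCurve E).contDiff.comp (contDiff_id.sub (hl.smul contDiff_const))).add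
      (hl.smul contDiff_const)
  let one : TimeInterval := ⟨1, by norm_num⟩
  let k : E → ℝ := fun z => primitive ℝ (g.comp (c z)) one
  have hk : ContDiff ℝ ∞ k :=
    (ContinuousMap.evalCLM ℝ one : C(TimeInterval, ℝ) →L[ℝ] ℝ).contDiff.comp
      ((primitive ℝ).contDiff.comp ((contDiff_comp_continuousMap g hG₁d).comp hc))
  have key : ∀ z, G₁ z - G₁ (z - l z • a) = l z * k z := by
    intro z
    have h1 : ∀ s : ℝ, HasDerivAt (fun s : ℝ => G₁ (z - l z • a + l z • s • a))
        (l z * fderiv ℝ G₁ (z - l z • a + l z • s • a) a) s := by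
      intro s
      have h2 : HasDerivAt (fun s : ℝ => z - l z • a + l z • s • a) (l z • a) s := by
        have := (((hasDerivAt_id s).smul_const a).const_smul (l z)).const_add (z - l z • a)
        simpa using this
      have := (hG₁.differentiable (by simp) _).hasFDerivAt.comp_hasDerivAt s h2
      rw [map_smul] at this
      exact this
    have h3 := intervalIntegral.integral_eq_sub_of_hasDerivAt (a := 0) (b := 1)
      (fun s _ => h1 s) (Continuous.intervalIntegrable (by
        refine continuous_const.mul (hG₁d.continuous.comp ?_)
        fun_prop) _ _)
    rw [one_smul, zero_smul, smul_zero, add_zero, sub_add_cancel,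
      intervalIntegral.integral_const_mul] at h3
    rw [← h3]
    congr 1
    simp only [k, primitive_apply, one]
    refine intervalIntegral.integral_congr fun s hs => ?_
    rw [uIcc_of_le zero_le_one] at hs
    have hs' : |s| ≤ 1 := abs_le.2 ⟨by linarith [hs.1], hs.2⟩
    simp only [toTime_of_abs_le hs']
    rfl
  refine ⟨k ∘ e, hk.comp hes, ?_⟩
  have hproj : ContinuousAt (fun x => e x - h x • a) y :=
    (hes.continuous.sub (hh.continuous.smul continuous_const)).continuousAt
  have hproj0 : e y - h y • a = y := by rw [hy, hey]; simp
  have hproj' : Tendsto (fun x => e x - h x • a) (𝓝 y) (𝓝 y) := by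
    have := hproj.tendsto; rwa [hproj0] at this
  have hsym' : Tendsto e.symm (𝓝 y) (𝓝 y) := by
    have := (e.continuousAt_symm hyt).tendsto; rwa [hsymy] at this
  have het : Tendsto e (𝓝 y) (𝓝 y) := by
    have := hes.continuous.tendsto y; rwa [hey] at this
  filter_upwards [e.open_source.mem_nhds hye, het.eventually hG₁e, hproj'.eventually hG₁e,
    hproj'.eventually (hsym'.eventually hv), hproj'.eventually (e.open_target.mem_nhds hyt)]
    with x hx h1 h2 h3 h4
  have hlx : l (e x) = h x := he x
  have h5 := key (e x)
  rw [hlx, h1, h2, Function.comp_apply, Function.comp_apply, e.left_inv hx, h3, sub_zero] at h5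
  · exact h5
  -- The projected point corresponds to a zero of `h`, where `G` vanishes.
  · have h6 := he (e.symm (e x - h x • a))
    rw [e.right_inv h4, sub_right_comm, map_sub, map_smul, ha, he x] at h6
    simpa using h6.symm

end Straightening

/-! ### Coordinates by flowing out of a hypersurface, and flow boxes -/

section CharacteristicCoordinates

variable {E : Type} [NormedAddCommGroup E] [NormedSpace ℝ E] [FiniteDimensional ℝ E]

/-- Flowing out transversally of the level sets of `h` gives local coordinates. -/
theorem exists_characteristic_coordinates {h : E → ℝ} (hh : ContDiff ℝ ∞ h) {y v : E}
    (hv : fderiv ℝ h y v ≠ 0) {X : ℝ × E → E} {S : Set (ℝ × E)} (hS : IsOpen S)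
    (hyS : ((0 : ℝ), y) ∈ S) (hX : ContDiffOn ℝ ∞ X S) (hX0 : ∀ᶠ x in 𝓝 y, X (0, x) = x)
    (hXt : HasDerivAt (fun t => X (t, y)) v 0) :
    ∃ e : OpenPartialHomeomorph (ℝ × E) (ℝ × E), (e : ℝ × E → ℝ × E) = (fun p => (h p.2, X p)) ∧
      ((0 : ℝ), y) ∈ e.source ∧ e.source ⊆ S ∧ ContDiffOn ℝ ∞ e.symm e.target := by
  have := FiniteDimensional.complete ℝ E
  let D := fderiv ℝ X (0, y)
  have hD : HasFDerivAt X D (0, y) :=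
    ((hX.contDiffAt (hS.mem_nhds hyS)).differentiableAt (by simp)).hasFDerivAt
  have hD1 : D (1, 0) = v := by
    have h1 : HasDerivAt (fun t : ℝ => (t, y)) ((1 : ℝ), (0 : E)) 0 :=
      (hasDerivAt_id 0).prodMk (hasDerivAt_const 0 y)
    exact (hD.comp_hasDerivAt (f := fun t : ℝ => (t, y)) 0 h1).unique hXt
  have hD2 : ∀ δ, D (0, δ) = δ := by
    intro δ
    have h1 : HasFDerivAt (fun x : E => ((0 : ℝ), x)) (ContinuousLinearMap.inr ℝ ℝ E) y :=
      (hasFDerivAt_const (0 : ℝ) y).prodMk (hasFDerivAt_id y)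
    have h2 := hD.comp (f := fun x : E => ((0 : ℝ), x)) y h1
    have h3 := h2.unique ((hasFDerivAt_id y).congr_of_eventuallyEq hX0)
    exact congrArg (fun L : E →L[ℝ] E => L δ) h3
  have hDa : ∀ τ δ, D (τ, δ) = τ • v + δ := by
    intro τ δ
    have : ((τ, δ) : ℝ × E) = τ • ((1 : ℝ), (0 : E)) + (0, δ) := by simp
    rw [this, map_add, map_smul, hD1, hD2]
  -- The derivative at `(0, y)` is `(τ, δ) ↦ (dh δ, τ v + δ)`, injective since `dh v ≠ 0`. Recording
  -- the level `h x` as a coordinate avoids parametrizing the hypersurface: the slice with first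
  -- coordinate `0` is the flow-out of `{h = 0}`.
  let L : ℝ × E →L[ℝ] ℝ × E := (fderiv ℝ h y ∘L ContinuousLinearMap.snd ℝ ℝ E).prod D
  have hL : Function.Injective (L : ℝ × E →ₗ[ℝ] ℝ × E) := by
    rw [← LinearMap.ker_eq_bot, LinearMap.ker_eq_bot']
    rintro ⟨τ, δ⟩ hz
    have h1 : fderiv ℝ h y δ = 0 := congrArg Prod.fst hz
    have h2 : D (τ, δ) = 0 := congrArg Prod.snd hz
    rw [hDa] at h2
    have h3 := congrArg (fderiv ℝ h y) h2
    rw [map_add, map_smul, h1, map_zero, add_zero, smul_eq_mul, mul_eq_zero] at h3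
    have h4 : τ = 0 := h3.resolve_right hv
    rw [h4, zero_smul, zero_add] at h2
    rw [h4, h2]; rfl
  let Le := (LinearEquiv.ofInjectiveEndo (L : ℝ × E →ₗ[ℝ] ℝ × E) hL).toContinuousLinearEquiv
  have hLe : (Le : ℝ × E →L[ℝ] ℝ × E) = L := by
    ext p <;> rfl
  have hd : HasFDerivAt (fun p : ℝ × E => (h p.2, X p)) (Le : ℝ × E →L[ℝ] ℝ × E) (0, y) := by
    rw [hLe]
    exact ((hh.differentiable (by simp) y).hasFDerivAt.comp (f := Prod.snd) ((0 : ℝ), y)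
      hasFDerivAt_snd).prodMk hD
  exact exists_openPartialHomeomorph_contDiffOn_symm hS
    ((hh.comp contDiff_snd).contDiffOn.prodMk hX) hyS Le hd

/-- Arbitrarily small flow boxes of a vector field transverse to the zero set of `h`. -/
theorem exists_flowBox {v : E → E} (hv : ContDiff ℝ ∞ v) {h : E → ℝ} (hh : ContDiff ℝ ∞ h)
    {y : E} (hy : h y = 0) (hvy : fderiv ℝ h y (v y) ≠ 0) {V : Set E} (hV : V ∈ 𝓝 y) :
    ∃ U : Set E, IsOpen U ∧ y ∈ U ∧ U ⊆ V ∧ IsPreconnected (U ∩ {x | h x = 0}) ∧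
      ∀ x ∈ U, ∃ (τ : ℝ) (γ : ℝ → E), γ 0 ∈ U ∩ {x | h x = 0} ∧ γ τ = x ∧
        ∀ t ∈ uIcc 0 τ, γ t ∈ U ∧ HasDerivAt γ (v (γ t)) t := by
  have := FiniteDimensional.complete ℝ E
  obtain ⟨r, hr, Φ, hΦ, hΦ0, hΦt⟩ := exists_smooth_flow hv y
  have hSo : IsOpen (Metric.ball (0 : ℝ) r ×ˢ Metric.ball y r) :=
    Metric.isOpen_ball.prod Metric.isOpen_ball
  have hyS : ((0 : ℝ), y) ∈ Metric.ball (0 : ℝ) r ×ˢ Metric.ball y r :=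
    ⟨Metric.mem_ball_self hr, Metric.mem_ball_self hr⟩
  have hΦy : Φ (0, y) = y := hΦ0 y (Metric.mem_ball_self hr)
  obtain ⟨e, he, hye, hes, hesymm⟩ := exists_characteristic_coordinates hh hvy hSo hyS hΦ
    (by filter_upwards [Metric.ball_mem_nhds y hr] with x hx using hΦ0 x hx)
    (by simpa [hΦy] using hΦt 0 (Metric.mem_ball_self hr) y (Metric.mem_ball_self hr))
  -- a neighbourhood `B` of `y` with `{0} × B` in the source
  have hB : ∀ᶠ x in 𝓝 y, ((0 : ℝ), x) ∈ e.source :=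
    (Continuous.prodMk_right (0 : ℝ)).continuousAt.preimage_mem_nhds (e.open_source.mem_nhds hye)
  have hBV : {x | ((0 : ℝ), x) ∈ e.source} ∩ V ∈ 𝓝 y := inter_mem hB hV
  have hcont : ContinuousAt Φ (0, y) := (hΦ.contDiffAt (hSo.mem_nhds hyS)).continuousAt
  have hpre : e.source ∩ Φ ⁻¹' ({x | ((0 : ℝ), x) ∈ e.source} ∩ V) ∈ 𝓝 ((0 : ℝ), y) :=
    inter_mem (e.open_source.mem_nhds hye) (hcont.preimage_mem_nhds (by rwa [hΦy]))
  obtain ⟨T, hT, D₀, hD₀, hTD⟩ := mem_nhds_prod_iff.1 hpre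
  obtain ⟨ρ, hρ, hρT⟩ := Metric.mem_nhds_iff.1 hT
  have hdh : fderiv ℝ h y ≠ 0 := fun h0 => hvy (by rw [h0]; rfl)
  obtain ⟨D, hDo, hyD, hDD, hDc⟩ := exists_isOpen_isPreconnected_inter_zero hh hy hdh hD₀
  have hbox : Metric.ball (0 : ℝ) ρ ×ˢ D ⊆
      e.source ∩ Φ ⁻¹' ({x | ((0 : ℝ), x) ∈ e.source} ∩ V) :=
    (prod_mono hρT hDD).trans hTD
  have h0ρ : (0 : ℝ) ∈ Metric.ball (0 : ℝ) ρ := Metric.mem_ball_self hρ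
  -- The points reached from `D ∩ {h = 0}` in time less than `ρ`.
  let U : Set E := (fun x => ((0 : ℝ), x)) ⁻¹'
    (e.target ∩ e.symm ⁻¹' (Metric.ball (0 : ℝ) ρ ×ˢ D))
  have hUo : IsOpen U :=
    (e.symm.isOpen_inter_preimage (Metric.isOpen_ball.prod hDo)).preimage
      (Continuous.prodMk_right (0 : ℝ))
  have hflow : ∀ t ∈ Metric.ball (0 : ℝ) ρ, ∀ x ∈ D, h x = 0 → Φ (t, x) ∈ U := by
    intro t ht x hx hx0
    have hsrc := (hbox (mk_mem_prod ht hx)).1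
    have himg : e (t, x) = (0, Φ (t, x)) := by rw [he]; simp [hx0]
    refine ⟨?_, ?_⟩
    · change ((0 : ℝ), Φ (t, x)) ∈ e.target
      rw [← himg]
      exact e.map_source hsrc
    · change e.symm (0, Φ (t, x)) ∈ Metric.ball (0 : ℝ) ρ ×ˢ D
      rw [← himg, e.left_inv hsrc]
      exact ⟨ht, hx⟩
  have hinv : ∀ x ∈ U, h (e.symm (0, x)).2 = 0 ∧ Φ (e.symm (0, x)) = x := by
    intro x hx
    have h1 := e.right_inv hx.1
    rw [he] at h1
    exact ⟨congrArg Prod.fst h1, congrArg Prod.snd h1⟩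
  have hUV : ∀ x ∈ U, ((0 : ℝ), x) ∈ e.source ∧ x ∈ V := by
    intro x hx
    have := (hbox hx.2).2
    rwa [mem_preimage, (hinv x hx).2] at this
  have hDball : ∀ x ∈ D, x ∈ Metric.ball y r := fun x hx =>
    (hes (hbox (mk_mem_prod h0ρ hx)).1).2
  have hDU : ∀ x ∈ D, h x = 0 → x ∈ U := by
    intro x hx hx0
    have := hflow 0 h0ρ x hx hx0
    rwa [hΦ0 x (hDball x hx)] at this
  -- A point of the surface has coordinates `(0, x)` and `e` is injective, so its base point is `x`
  -- itself. This transfers the connectedness of `D ∩ {h = 0}` to `U`.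
  have hUH : U ∩ {x | h x = 0} = D ∩ {x | h x = 0} := by
    ext x
    constructor
    · rintro ⟨hx, hx0⟩
      refine ⟨?_, hx0⟩
      have hsrc := (hUV x hx).1
      have himg : e (0, x) = (0, x) := by
        rw [he]
        simp only [show h x = 0 from hx0, hΦ0 x (hes hsrc).2]
      have h2 := hx.2.2
      change (e.symm (0, x)).2 ∈ D at h2
      rwa [← himg, e.left_inv hsrc] at h2
    · rintro ⟨hx, hx0⟩
      exact ⟨hDU x hx hx0, hx0⟩
  refine ⟨U, hUo, hDU y hyD hy, fun x hx => (hUV x hx).2, hUH ▸ hDc, ?_⟩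
  intro x hx
  obtain ⟨hz0, hz1⟩ := hinv x hx
  obtain ⟨ht, hz⟩ := hx.2
  set z := (e.symm (0, x)).2 with hzdef
  set τ := (e.symm (0, x)).1 with hτdef
  refine ⟨τ, fun t => Φ (t, z), ?_, hz1, ?_⟩
  · change Φ (0, z) ∈ _
    rw [hΦ0 z (hDball z hz)]
    exact ⟨hDU z hz hz0, hz0⟩
  · intro t htt
    have htρ : t ∈ Metric.ball (0 : ℝ) ρ :=
      (convex_ball (0 : ℝ) ρ).ordConnected.uIcc_subset h0ρ ht htt
    exact ⟨hflow t htρ z hz hz0, hΦt t (hes (hbox (mk_mem_prod htρ hz)).1).1 z (hDball z hz)⟩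

end CharacteristicCoordinates

/-! ### The method of characteristics -/

section HamiltonJacobi

theorem eq_of_hasDerivAt_zero {s : Set ℝ} (hs : Convex ℝ s) {f : ℝ → ℝ}
    (hf : ∀ t ∈ s, HasDerivAt f 0 t) {a b : ℝ} (ha : a ∈ s) (hb : b ∈ s) : f b = f a := by
  have := hs.norm_image_sub_le_of_norm_hasDerivWithin_le (C := 0)
    (fun t ht => (hf t ht).hasDerivWithinAt) (fun _ _ => by simp) ha hb
  rw [zero_mul] at this
  exact sub_eq_zero.1 (norm_le_zero_iff.1 this)

/-- The variational equation along a flow. -/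
theorem hasDerivAt_variation {E : Type*} [NormedAddCommGroup E] [NormedSpace ℝ E]
    {Y : Type*} [NormedAddCommGroup Y] [NormedSpace ℝ Y] {Q : ℝ × E → Y} {S : Set (ℝ × E)}
    (hS : IsOpen S) (hQ : ContDiffOn ℝ ∞ Q S) {W : Y → Y} (hW : Differentiable ℝ W)
    (hQW : ∀ z ∈ S, fderiv ℝ Q z (1, 0) = W (Q z)) {t : ℝ} {x : E} (hz : (t, x) ∈ S) (δ : E) :
    HasDerivAt (fun s => fderiv ℝ Q (s, x) (0, δ))
      (fderiv ℝ W (Q (t, x)) (fderiv ℝ Q (t, x) (0, δ))) t := by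
  have hc : ContDiffAt ℝ ∞ Q (t, x) := hQ.contDiffAt (hS.mem_nhds hz)
  have hd2 : HasFDerivAt (fderiv ℝ Q) (fderiv ℝ (fderiv ℝ Q) (t, x)) (t, x) :=
    ((hc.fderiv_right (m := ∞) (by simp)).differentiableAt (by simp)).hasFDerivAt
  -- Symmetry of the second derivative interchanges the time derivative with the variation `δ`.
  have hsymm : IsSymmSndFDerivAt ℝ Q (t, x) :=
    hc.isSymmSndFDerivAt (by
      rw [minSmoothness_of_isRCLikeNormedField]
      exact WithTop.coe_le_coe.2 (le_top : (2 : ℕ∞) ≤ ⊤))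
  have h1 : HasDerivAt (fun s : ℝ => (s, x)) ((1 : ℝ), (0 : E)) t :=
    (hasDerivAt_id t).prodMk (hasDerivAt_const t x)
  have h2 := (hd2.comp_hasDerivAt (f := fun s : ℝ => (s, x)) t h1).clm_apply
    (hasDerivAt_const t ((0 : ℝ), δ))
  have h3 : HasFDerivAt (fun z => fderiv ℝ Q z (1, 0))
      (fderiv ℝ W (Q (t, x)) ∘L fderiv ℝ Q (t, x)) (t, x) := by
    refine HasFDerivAt.congr_of_eventuallyEq ?_
      (by filter_upwards [hS.mem_nhds hz] with z hz using hQW z hz)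
    exact (hW _).hasFDerivAt.comp _ (hc.differentiableAt (by simp)).hasFDerivAt
  have h4 := h3.unique (hd2.clm_apply (hasFDerivAt_const ((1 : ℝ), (0 : E)) (t, x)))
  have h5 := congrArg (fun L => L ((0 : ℝ), δ)) h4
  convert! h2 using 1
  have h6 := hsymm.eq (1, 0) (0, δ)
  simp at h5 h6 ⊢
  rw [h6, ← h5]

variable {E : Type} [NormedAddCommGroup E] [NormedSpace ℝ E]

/-- The characteristic vector field of a Hamiltonian `F(x, p)` with momentum derivative `v`. -/
noncomputable def characteristicField (F : E × (E →L[ℝ] ℝ) → ℝ) (v : E × (E →L[ℝ] ℝ) → E)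
    (z : E × (E →L[ℝ] ℝ) × ℝ) : E × (E →L[ℝ] ℝ) × ℝ :=
  (v (z.1, z.2.1), -(fderiv ℝ F (z.1, z.2.1) ∘L ContinuousLinearMap.inl ℝ E (E →L[ℝ] ℝ)),
    z.2.1 (v (z.1, z.2.1)))

variable {F : E × (E →L[ℝ] ℝ) → ℝ} {v : E × (E →L[ℝ] ℝ) → E}

theorem contDiff_characteristicField (hF : ContDiff ℝ ∞ F) (hv : ContDiff ℝ ∞ v) :
    ContDiff ℝ ∞ (characteristicField F v) := by
  have h0 : ContDiff ℝ ∞ fun z : E × (E →L[ℝ] ℝ) × ℝ => (z.1, z.2.1) :=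
    contDiff_fst.prodMk (contDiff_fst.comp contDiff_snd)
  have h1 := hv.comp h0
  have h2 : ContDiff ℝ ∞ fun z : E × (E →L[ℝ] ℝ) × ℝ => fderiv ℝ F (z.1, z.2.1) :=
    (hF.fderiv_right (m := ∞) (by simp)).comp h0
  exact h1.prodMk ((h2.clm_comp contDiff_const).neg.prodMk
    ((contDiff_fst.comp contDiff_snd).clm_apply h1))

/-- Derivatives of the contact form and the Hamiltonian along the variational equation. -/
theorem fderiv_characteristicField (hF : ContDiff ℝ ∞ F) (hv : ContDiff ℝ ∞ v)
    (z q : E × (E →L[ℝ] ℝ) × ℝ) :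
    (fderiv ℝ (characteristicField F v) z q).2.2 = q.2.1 (v (z.1, z.2.1)) +
      z.2.1 (fderiv ℝ (characteristicField F v) z q).1 := by
  have hW := ((contDiff_characteristicField hF hv).differentiable (by simp) z).hasFDerivAt
  have h1 : HasFDerivAt (fun z => v (z.1, z.2.1)) _ z := hW.fst
  have h2 : HasFDerivAt (fun z : E × (E →L[ℝ] ℝ) × ℝ => z.2.1 (v (z.1, z.2.1))) _ z := hW.snd.snd
  have h3 : HasFDerivAt (fun z : E × (E →L[ℝ] ℝ) × ℝ => z.2.1) (ContinuousLinearMap.fst ℝ _ _ ∘L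
    ContinuousLinearMap.snd ℝ _ _) z := hasFDerivAt_fst.comp z hasFDerivAt_snd
  have h4 := congrArg (fun L => L q) (h2.unique (h3.clm_apply h1))
  simp at h4
  rw [h4, add_comm]

variable [FiniteDimensional ℝ E]

/-- Local solvability of the noncharacteristic Cauchy problem for `F(x, du) = 0`, with
`u = 0` on `{h = 0}` and prescribed initial momentum `p₀`. -/
theorem exists_hamiltonJacobi_solution (hF : ContDiff ℝ ∞ F) (hv : ContDiff ℝ ∞ v)
    {p₀ : E → E →L[ℝ] ℝ} (hp₀ : ContDiff ℝ ∞ p₀) {h : E → ℝ} (hh : ContDiff ℝ ∞ h) {y : E}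
    (hy : h y = 0)
    (hFv : ∀ᶠ x in 𝓝 y, ∀ p π, fderiv ℝ F (x, p) (0, π) = π (v (x, p)))
    (hp₀F : ∀ᶠ x in 𝓝 y, F (x, p₀ x) = 0)
    (hp₀h : ∀ᶠ x in 𝓝 y, ∀ δ, fderiv ℝ h x δ = 0 → p₀ x δ = 0)
    (hvy : fderiv ℝ h y (v (y, p₀ y)) ≠ 0) :
    ∃ (U : Set E) (u : E → ℝ), IsOpen U ∧ y ∈ U ∧ ContDiffOn ℝ ∞ u U ∧
      (∀ x ∈ U, F (x, fderiv ℝ u x) = 0) ∧ ∀ x ∈ U, h x = 0 → u x = 0 := by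
  have := FiniteDimensional.complete ℝ E
  set W := characteristicField F v with hWdef
  have hW : ContDiff ℝ ∞ W := contDiff_characteristicField hF hv
  obtain ⟨r, hr, Φ, hΦ, hΦ0, hΦt⟩ := exists_smooth_flow hW (y, p₀ y, 0)
  -- The initial strip: position, momentum, and the value `u = 0`.
  let ι : E → E × (E →L[ℝ] ℝ) × ℝ := fun x => (x, p₀ x, 0)
  have hι : ContDiff ℝ ∞ ι := contDiff_id.prodMk (hp₀.prodMk contDiff_const)
  let Q : ℝ × E → E × (E →L[ℝ] ℝ) × ℝ := fun p => Φ (p.1, ι p.2)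
  have hΨ : ContDiff ℝ ∞ fun p : ℝ × E => (p.1, ι p.2) :=
    contDiff_fst.prodMk (hι.comp contDiff_snd)
  obtain ⟨A, hA, hAo, hyA⟩ := eventually_nhds_iff.1 (hFv.and (hp₀F.and hp₀h))
  let S₀ : Set (ℝ × E) := (fun p : ℝ × E => (p.1, ι p.2)) ⁻¹'
    (Metric.ball (0 : ℝ) r ×ˢ Metric.ball (y, p₀ y, (0 : ℝ)) r)
  have hS₀ : IsOpen S₀ := (Metric.isOpen_ball.prod Metric.isOpen_ball).preimage hΨ.continuous
  have hyS₀ : ((0 : ℝ), y) ∈ S₀ := ⟨Metric.mem_ball_self hr, Metric.mem_ball_self hr⟩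
  have hQ₀ : ContDiffOn ℝ ∞ Q S₀ := hΦ.comp hΨ.contDiffOn fun _ h => h
  have hQy : Q (0, y) = ι y := hΦ0 _ (Metric.mem_ball_self hr)
  have hnear : S₀ ∩ (fun p : ℝ × E => (Q p).1) ⁻¹' A ∩ Prod.snd ⁻¹' A ∈ 𝓝 ((0 : ℝ), y) := by
    refine inter_mem (inter_mem (hS₀.mem_nhds hyS₀) ?_)
      (continuous_snd.continuousAt.preimage_mem_nhds (hAo.mem_nhds hyA))
    have : ContinuousAt (fun p : ℝ × E => (Q p).1) (0, y) :=
      (hQ₀.contDiffAt (hS₀.mem_nhds hyS₀)).continuousAt.fst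
    exact this.preimage_mem_nhds (hAo.mem_nhds (by rw [hQy]; exact hyA))
  obtain ⟨T, hT, B₀, hB₀, hTB⟩ := mem_nhds_prod_iff.1 hnear
  obtain ⟨ρ, hρ, hρT⟩ := Metric.mem_nhds_iff.1 hT
  obtain ⟨B, hBB, hBo, hyB⟩ := mem_nhds_iff.1 hB₀
  set S : Set (ℝ × E) := Metric.ball (0 : ℝ) ρ ×ˢ B with hSdef
  have hSo : IsOpen S := Metric.isOpen_ball.prod hBo
  have h0ρ : (0 : ℝ) ∈ Metric.ball (0 : ℝ) ρ := Metric.mem_ball_self hρ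
  have hyS : ((0 : ℝ), y) ∈ S := ⟨h0ρ, hyB⟩
  have hSsub : S ⊆ S₀ ∩ (fun p : ℝ × E => (Q p).1) ⁻¹' A ∩ Prod.snd ⁻¹' A :=
    (prod_mono hρT hBB).trans hTB
  have hQ : ContDiffOn ℝ ∞ Q S := hQ₀.mono fun p hp => (hSsub hp).1.1
  have hQd : ∀ z ∈ S, HasFDerivAt Q (fderiv ℝ Q z) z := fun z hz =>
    ((hQ.contDiffAt (hSo.mem_nhds hz)).differentiableAt (by simp)).hasFDerivAt
  have hQ0 : ∀ x ∈ B, Q (0, x) = ι x := fun x hx =>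
    hΦ0 _ (hSsub (mk_mem_prod h0ρ hx)).1.1.2
  have hQt : ∀ t x, (t, x) ∈ S → HasDerivAt (fun s => Q (s, x)) (W (Q (t, x))) t :=
    fun t x hz => hΦt t (hSsub hz).1.1.1 _ (hSsub hz).1.1.2
  have hQW : ∀ z ∈ S, fderiv ℝ Q z (1, 0) = W (Q z) := by
    rintro ⟨t, x⟩ hz
    have h1 : HasDerivAt (fun s : ℝ => (s, x)) ((1 : ℝ), (0 : E)) t :=
      (hasDerivAt_id t).prodMk (hasDerivAt_const t x)
    exact ((hQd _ hz).comp_hasDerivAt (f := fun s : ℝ => (s, x)) t h1).unique (hQt t x hz)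
  -- conservation of `F`
  have hcons : ∀ z ∈ S, F ((Q z).1, (Q z).2.1) = 0 := by
    rintro ⟨t, x⟩ hz
    have hd : ∀ s ∈ Metric.ball (0 : ℝ) ρ,
        HasDerivAt (fun s => F ((Q (s, x)).1, (Q (s, x)).2.1)) 0 s := by
      intro s hs
      have hsS : (s, x) ∈ S := ⟨hs, hz.2⟩
      have h1 := hQt s x hsS
      have h2 : HasDerivAt (fun s => ((Q (s, x)).1, (Q (s, x)).2.1))
          ((W (Q (s, x))).1, (W (Q (s, x))).2.1) s := h1.fst.prodMk h1.snd.fst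
      have h3 := (hF.differentiable (by simp) _).hasFDerivAt.comp_hasDerivAt s h2
      convert! h3 using 1
      have h4 := (hA _ (hSsub hsS).1.2).1 (Q (s, x)).2.1 (W (Q (s, x))).2.1
      have h5 : ((W (Q (s, x))).1, (W (Q (s, x))).2.1) =
          ((W (Q (s, x))).1, 0) + (0, (W (Q (s, x))).2.1) := by simp
      rw [h5, map_add, h4]
      simp [hWdef, characteristicField]
    have := eq_of_hasDerivAt_zero (convex_ball 0 ρ) hd h0ρ hz.1
    rw [this, hQ0 x hz.2]
    exact (hA x (hSsub hz).2).2.1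
  -- the contact form vanishes on variations tangent to the level sets of `h`
  have hcontact : ∀ z ∈ S, ∀ δ, fderiv ℝ h z.2 δ = 0 →
      (fderiv ℝ Q z (0, δ)).2.2 = (Q z).2.1 (fderiv ℝ Q z (0, δ)).1 := by
    rintro ⟨t, x⟩ hz δ hδ
    have hx : x ∈ B := hz.2
    have hd : ∀ s ∈ Metric.ball (0 : ℝ) ρ, HasDerivAt (fun s => (fderiv ℝ Q (s, x) (0, δ)).2.2
        - (Q (s, x)).2.1 (fderiv ℝ Q (s, x) (0, δ)).1) 0 s := by
      intro s hs
      have hsS : (s, x) ∈ S := ⟨hs, hx⟩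
      have h1 := hasDerivAt_variation hSo hQ (hW.differentiable (by simp)) hQW hsS δ
      have h1P : HasDerivAt (fun s => (Q (s, x)).2.1) (W (Q (s, x))).2.1 s :=
        (hQt s x hsS).snd.fst
      have h1X : HasDerivAt (fun s => (fderiv ℝ Q (s, x) (0, δ)).1) _ s := h1.fst
      have h1u : HasDerivAt (fun s => (fderiv ℝ Q (s, x) (0, δ)).2.2) _ s := h1.snd.snd
      have h2 := h1u.sub (h1P.clm_apply h1X)
      convert! h2 using 1
      -- The derivative of `δu - P(δX)` is `δP(v) + F_x(δX)`, which is the variation of `F` along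
      -- `δ` and so vanishes by conservation.
      set q := fderiv ℝ Q (s, x) (0, δ) with hq
      rw [fderiv_characteristicField hF hv]
      -- the derivative of the conserved quantity
      have h3 : HasFDerivAt (fun z => F ((Q z).1, (Q z).2.1)) (0 : ℝ × E →L[ℝ] ℝ) (s, x) :=
        (hasFDerivAt_const (0 : ℝ) _).congr_of_eventuallyEq
          (by filter_upwards [hSo.mem_nhds hsS] with z hz using hcons z hz)
      have h4 := (hF.differentiable (by simp) _).hasFDerivAt.comp (s, x)
        ((hQd _ hsS).fst.prodMk (hQd _ hsS).snd.fst)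
      have h5 := congrArg (fun L => L ((0 : ℝ), δ)) (h3.unique h4)
      have h6 : fderiv ℝ F ((Q (s, x)).1, (Q (s, x)).2.1) (q.1, q.2.1) = 0 := h5.symm
      have h7 : (q.1, q.2.1) = (q.1, 0) + (0, q.2.1) := by simp
      rw [h7, map_add, (hA _ (hSsub hsS).1.2).1] at h6
      simp only [hWdef, characteristicField, neg_apply,
        ContinuousLinearMap.comp_apply, ContinuousLinearMap.inl_apply]
      linear_combination -h6
    have h0 := eq_of_hasDerivAt_zero (convex_ball 0 ρ) hd h0ρ hz.1
    have h8 : fderiv ℝ Q (0, x) (0, δ) = fderiv ℝ ι x δ := by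
      have hxS : ((0 : ℝ), x) ∈ S := ⟨h0ρ, hx⟩
      have h1 : HasFDerivAt (fun x : E => ((0 : ℝ), x)) (ContinuousLinearMap.inr ℝ ℝ E) x :=
        (hasFDerivAt_const (0 : ℝ) x).prodMk (hasFDerivAt_id x)
      have h2 := (hQd _ hxS).comp (f := fun x : E => ((0 : ℝ), x)) x h1
      have h3 := h2.unique ((hι.differentiable (by simp) x).hasFDerivAt.congr_of_eventuallyEq
        (by filter_upwards [hBo.mem_nhds hx] with z hz using hQ0 z hz))
      exact congrArg (fun L => L δ) h3
    have h9 : HasFDerivAt ι ((ContinuousLinearMap.id ℝ E).prod ((fderiv ℝ p₀ x).prod 0)) x :=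
      (hasFDerivAt_id x).prodMk ((hp₀.differentiable (by simp) x).hasFDerivAt.prodMk
        (hasFDerivAt_const (0 : ℝ) x))
    rw [h8, h9.fderiv, hQ0 x hx] at h0
    have h10 := (hA x (hSsub hz).2).2.2 δ hδ
    -- At time zero the contact form is `-p₀ x δ`, which vanishes for `δ` in the kernel of `dh`.
    have h11 : (0 : ℝ) - p₀ x δ = 0 := by rw [h10, sub_zero]
    exact sub_eq_zero.1 (h0.trans h11)
  -- assembling the solution
  have hvy' : fderiv ℝ h y (W (Q (0, y))).1 ≠ 0 := by rw [hQy]; exact hvy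
  obtain ⟨e, he, hye, hes, hesymm⟩ := exists_characteristic_coordinates hh
    (X := fun z => (Q z).1) hvy' hSo hyS hQ.fst
    (by filter_upwards [hBo.mem_nhds hyB] with x hx; rw [hQ0 x hx]) (hQt 0 y hyS).fst
  let σ : E → ℝ × E := fun x => e.symm (0, x)
  -- `σ x` is the time and the starting point on `{h = 0}` of the characteristic through `x`. The
  -- second condition forces `σ x = (0, x)` on the surface, which gives the initial values.
  let U : Set E := (fun x => ((0 : ℝ), x)) ⁻¹' e.target ∩ {x | ((0 : ℝ), x) ∈ e.source}
  have hc0 : Continuous fun x : E => ((0 : ℝ), x) := Continuous.prodMk_right (0 : ℝ)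
  have hUo : IsOpen U := (e.open_target.preimage hc0).inter (e.open_source.preimage hc0)
  have hey : e (0, y) = (0, y) := by
    rw [he]; simp only [hy, hQy]; rfl
  have hσ : ContDiffOn ℝ ∞ σ U :=
    hesymm.comp (contDiff_const.prodMk contDiff_id).contDiffOn fun x hx => hx.1
  have hσS : ∀ x ∈ U, σ x ∈ S := fun x hx => hes (e.map_target hx.1)
  have hinv : ∀ x ∈ U, h (σ x).2 = 0 ∧ (Q (σ x)).1 = x := by
    intro x hx
    have h1 := e.right_inv hx.1
    rw [he] at h1
    exact ⟨congrArg Prod.fst h1, congrArg Prod.snd h1⟩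
  have hσd : ∀ x ∈ U, HasFDerivAt σ (fderiv ℝ σ x) x := fun x hx =>
    ((hσ.contDiffAt (hUo.mem_nhds hx)).differentiableAt (by simp)).hasFDerivAt
  refine ⟨U, fun x => (Q (σ x)).2.2, hUo, ⟨?_, hye⟩, (hQ.comp hσ hσS).snd.snd, ?_, ?_⟩
  · change ((0 : ℝ), y) ∈ e.target
    rw [← hey]; exact e.map_source hye
  · intro x hx
    have hd : fderiv ℝ (fun x => (Q (σ x)).2.2) x = (Q (σ x)).2.1 := by
      have hQσ := (hQd _ (hσS x hx)).comp x (hσd x hx)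
      have hU : HasFDerivAt (fun x => (Q (σ x)).2.2) _ x := hQσ.snd.snd
      rw [hU.fderiv]
      ext w
      have h1 : fderiv ℝ h (σ x).2 (fderiv ℝ σ x w).2 = 0 := by
        have h2 : HasFDerivAt (fun x => h (σ x).2) (0 : E →L[ℝ] ℝ) x :=
          (hasFDerivAt_const (0 : ℝ) x).congr_of_eventuallyEq
            (by filter_upwards [hUo.mem_nhds hx] with z hz using (hinv z hz).1)
        have h3 := (hh.differentiable (by simp) _).hasFDerivAt.comp x (hσd x hx).snd
        exact (congrArg (fun L => L w) (h2.unique h3)).symm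
      have h4 : (fderiv ℝ Q (σ x) (fderiv ℝ σ x w)).1 = w := by
        have h5 : HasFDerivAt (fun x => (Q (σ x)).1) (ContinuousLinearMap.id ℝ E) x :=
          (hasFDerivAt_id x).congr_of_eventuallyEq
            (by filter_upwards [hUo.mem_nhds hx] with z hz using (hinv z hz).2)
        exact congrArg (fun L => L w) (hQσ.fst.unique h5)
      change (fderiv ℝ Q (σ x) (fderiv ℝ σ x w)).2.2 = (Q (σ x)).2.1 w
      conv_rhs => rw [← h4]
      -- Split into the flow direction, where the contact form vanishes because `u̇ = P(v)`, and a
      -- direction tangent to the levels of `h`, where it vanishes by `hcontact`. Hence `du = P`.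
      have h6 : fderiv ℝ σ x w =
          (fderiv ℝ σ x w).1 • ((1 : ℝ), (0 : E)) + (0, (fderiv ℝ σ x w).2) := by simp
      rw [h6, map_add, map_smul, hQW _ (hσS x hx)]
      have h7 := hcontact _ (hσS x hx) _ h1
      simp only [Prod.snd_add, Prod.fst_add, Prod.smul_fst, Prod.smul_snd, map_add, map_smul, h7]
      rfl
    rw [hd]
    have := hcons _ (hσS x hx)
    rwa [(hinv x hx).2] at this
  · intro x hx hx0
    have hxS := hes hx.2
    have himg : e (0, x) = (0, x) := by
      rw [he]; simp only [hx0, hQ0 x hxS.2]; rfl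
    have : σ x = (0, x) := by
      change e.symm (0, x) = _
      conv_lhs => rw [← himg]
      exact e.left_inv hx.2
    change (Q (σ x)).2.2 = 0
    rw [this, hQ0 x hxS.2]

end HamiltonJacobi

/-! ### Local existence in coordinates -/

section LocalGauge

variable {E : Type} [NormedAddCommGroup E] [NormedSpace ℝ E]

/-- A smooth function vanishing on `{h = 0}` has differential proportional to `dh`. -/
theorem exists_fderiv_eq_smul_of_vanishes [FiniteDimensional ℝ E] {h : E → ℝ}
    (hh : ContDiff ℝ ∞ h) {y : E} (hy : h y = 0) (hd : fderiv ℝ h y ≠ 0) {G : E → ℝ} {s : Set E}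
    (hs : IsOpen s) (hys : y ∈ s) (hG : ContDiffOn ℝ ∞ G s)
    (hv : ∀ᶠ x in 𝓝 y, h x = 0 → G x = 0) :
    ∃ c : ℝ, fderiv ℝ G y = c • fderiv ℝ h y := by
  obtain ⟨G₁, hG₁, hGe⟩ := exists_contDiff_eventuallyEq hs hG hys
  obtain ⟨k, hk, hGk⟩ := exists_eq_mul_of_vanishes hh hy hd hG₁
    (by filter_upwards [hv, hGe] with x h1 h2 h3; rw [h2, h1 h3])
  refine ⟨k y, ?_⟩
  have h1 : G =ᶠ[𝓝 y] fun x => h x * k x := hGe.symm.trans hGk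
  have h2 := (hh.differentiable (by simp) y).hasFDerivAt.mul
    (hk.differentiable (by simp) y).hasFDerivAt
  rw [h1.fderiv_eq]
  refine h2.fderiv.trans ?_
  rw [hy, zero_smul, zero_add]

/-- Gronwall's inequality with zero initial value; rescaling time to `[0, 1]` treats both signs of
`τ` together. -/
theorem eq_zero_of_norm_deriv_le {f f' : ℝ → E} {τ C : ℝ}
    (hf : ∀ t ∈ uIcc 0 τ, HasDerivAt f (f' t) t) (hC : ∀ t ∈ uIcc 0 τ, ‖f' t‖ ≤ C * ‖f t‖)
    (h0 : f 0 = 0) : f τ = 0 := by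
  have hmem : ∀ s ∈ Icc (0 : ℝ) 1, τ * s ∈ uIcc 0 τ := by
    intro s hs
    have := (convex_uIcc (0 : ℝ) τ).add_smul_sub_mem left_mem_uIcc right_mem_uIcc hs
    simpa [mul_comm] using this
  have hd : ∀ s ∈ Icc (0 : ℝ) 1, HasDerivAt (fun s => f (τ * s)) (τ • f' (τ * s)) s := by
    intro s hs
    have h1 : HasDerivAt (fun s : ℝ => τ * s) τ s := by
      simpa using (hasDerivAt_id s).const_mul τ
    exact HasDerivAt.scomp s (hf _ (hmem s hs)) h1
  have h := norm_le_gronwallBound_of_norm_deriv_right_le (f := fun s => f (τ * s))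
    (f' := fun s => τ • f' (τ * s)) (δ := 0) (K := |τ| * C) (ε := 0) (a := 0) (b := 1)
    (fun s hs => (hd s hs).continuousAt.continuousWithinAt)
    (fun s hs => (hd s (Ico_subset_Icc_self hs)).hasDerivWithinAt) (by simp [h0])
    (fun s hs => by
      rw [norm_smul, add_zero, mul_assoc]
      exact mul_le_mul_of_nonneg_left (hC _ (hmem s (Ico_subset_Icc_self hs))) (abs_nonneg _))
    1 (right_mem_Icc.2 zero_le_one)
  simpa [gronwallBound_ε0_δ0] using h

/-- The null condition for `ρ Ω`, expanded. -/
theorem fderiv_mul_null_expand {A : (E →L[ℝ] ℝ) →L[ℝ] E} (hA : ∀ p π : E →L[ℝ] ℝ, p (A π) = π (A p))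
    {ρ Ω : E → ℝ} {x : E} (hρ : DifferentiableAt ℝ ρ x) (hΩ : DifferentiableAt ℝ Ω x) :
    fderiv ℝ (fun z => ρ z * Ω z) x (A (fderiv ℝ (fun z => ρ z * Ω z) x)) =
      ρ x ^ 2 * fderiv ℝ Ω x (A (fderiv ℝ Ω x))
        + Ω x * (2 * ρ x * fderiv ℝ ρ x (A (fderiv ℝ Ω x))
          + Ω x * fderiv ℝ ρ x (A (fderiv ℝ ρ x))) := by
  have h1 : fderiv ℝ (fun z => ρ z * Ω z) x = ρ x • fderiv ℝ Ω x + Ω x • fderiv ℝ ρ x :=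
    (hρ.hasFDerivAt.mul hΩ.hasFDerivAt).fderiv
  rw [h1]
  simp only [map_add, map_smul, add_apply, smul_apply, smul_eq_mul]
  rw [hA (fderiv ℝ Ω x) (fderiv ℝ ρ x)]
  ring

theorem contDiff_inverseMetric_apply {A : E → (E →L[ℝ] ℝ) →L[ℝ] E} (hA : ContDiff ℝ ∞ A)
    {f : E → ℝ} (hf : ContDiff ℝ ∞ f) : ContDiff ℝ ∞ fun x => A x (fderiv ℝ f x) :=
  hA.clm_apply (hf.fderiv_right (m := ∞) (by simp))

variable [FiniteDimensional ℝ E]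

/-- Local existence of the gauge, in coordinates. -/
theorem exists_local_gauge {A : E → (E →L[ℝ] ℝ) →L[ℝ] E} (hA : ContDiff ℝ ∞ A) {Ω h : E → ℝ}
    (hΩ : ContDiff ℝ ∞ Ω) (hh : ContDiff ℝ ∞ h) {y : E}
    (hsymm : ∀ᶠ x in 𝓝 y, ∀ p π : E →L[ℝ] ℝ, p (A x π) = π (A x p))
    (hΩy : Ω y = 0) (hy : h y = 0) (htr : fderiv ℝ h y (A y (fderiv ℝ Ω y)) ≠ 0)
    (hnull : ∀ᶠ x in 𝓝 y, Ω x = 0 → fderiv ℝ Ω x (A x (fderiv ℝ Ω x)) = 0) :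
    ∃ (U : Set E) (ρ : E → ℝ), IsOpen U ∧ y ∈ U ∧ ContDiffOn ℝ ∞ ρ U ∧ (∀ x ∈ U, 0 < ρ x) ∧
      (∀ x ∈ U, fderiv ℝ (fun z => ρ z * Ω z) x (A x (fderiv ℝ (fun z => ρ z * Ω z) x)) = 0) ∧
      ∀ x ∈ U, h x = 0 → ρ x = 1 := by
  have hdΩ : ContDiff ℝ ∞ (fderiv ℝ Ω) := hΩ.fderiv_right (m := ∞) (by simp)
  have hdh : ContDiff ℝ ∞ (fderiv ℝ h) := hh.fderiv_right (m := ∞) (by simp)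
  have hξ := contDiff_inverseMetric_apply hA hΩ
  have hη := contDiff_inverseMetric_apply hA hh
  have hΩ0 : fderiv ℝ Ω y ≠ 0 := fun h0 => htr (by rw [h0]; simp)
  obtain ⟨f, hf, hfe⟩ := exists_eq_mul_of_vanishes hΩ hΩy hΩ0 (hdΩ.clm_apply hξ) hnull
  -- the Hamiltonian
  let F : E × (E →L[ℝ] ℝ) → ℝ := fun z =>
    f z.1 + 2 * z.2 (A z.1 (fderiv ℝ Ω z.1)) + Ω z.1 * z.2 (A z.1 z.2)
  let v : E × (E →L[ℝ] ℝ) → E := fun z =>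
    (2 : ℝ) • A z.1 (fderiv ℝ Ω z.1) + (2 * Ω z.1) • A z.1 z.2
  have hA1 : ContDiff ℝ ∞ fun z : E × (E →L[ℝ] ℝ) => A z.1 z.2 :=
    (hA.comp contDiff_fst).clm_apply contDiff_snd
  have hξ1 : ContDiff ℝ ∞ fun z : E × (E →L[ℝ] ℝ) => A z.1 (fderiv ℝ Ω z.1) :=
    hξ.comp contDiff_fst
  have hΩ1 : ContDiff ℝ ∞ fun z : E × (E →L[ℝ] ℝ) => Ω z.1 := hΩ.comp contDiff_fst
  have hF : ContDiff ℝ ∞ F :=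
    ((hf.comp contDiff_fst).add (contDiff_const.mul (contDiff_snd.clm_apply hξ1))).add
      (hΩ1.mul (contDiff_snd.clm_apply hA1))
  have hv : ContDiff ℝ ∞ v :=
    (contDiff_const.smul hξ1).add ((contDiff_const.mul hΩ1).smul hA1)
  have hFv : ∀ᶠ x in 𝓝 y, ∀ p π, fderiv ℝ F (x, p) (0, π) = π (v (x, p)) := by
    filter_upwards [hsymm] with x hx p π
    have h1 : HasFDerivAt (fun p : E →L[ℝ] ℝ => (x, p)) (ContinuousLinearMap.inr ℝ E _) p :=
      (hasFDerivAt_const x p).prodMk (hasFDerivAt_id p)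
    have h2 := (hF.differentiable (by simp) (x, p)).hasFDerivAt.comp
      (f := fun p : E →L[ℝ] ℝ => (x, p)) p h1
    have h3 : HasFDerivAt (fun p : E →L[ℝ] ℝ => p (A x p)) _ p :=
      (hasFDerivAt_id p).clm_apply (A x).hasFDerivAt
    have h4 : HasFDerivAt (fun p : E →L[ℝ] ℝ => p (A x (fderiv ℝ Ω x))) _ p :=
      (hasFDerivAt_id p).clm_apply (hasFDerivAt_const (A x (fderiv ℝ Ω x)) p)
    have h5 : HasFDerivAt (fun p : E →L[ℝ] ℝ =>
        f x + 2 * p (A x (fderiv ℝ Ω x)) + Ω x * p (A x p)) _ p :=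
      ((h4.const_mul 2).const_add (f x)).add (h3.const_mul (Ω x))
    have h6 := congrArg (fun L => L π) (h2.unique h5)
    change fderiv ℝ F (x, p) (0, π) = _ at h6
    rw [h6]
    simp [v, hx p π]
    ring
  -- the initial momentum, a root of a quadratic polynomial
  let b : E → ℝ := fun x => 2 * fderiv ℝ h x (A x (fderiv ℝ Ω x))
  let c : E → ℝ := fun x => Ω x * fderiv ℝ h x (A x (fderiv ℝ h x))
  have hb : ContDiff ℝ ∞ b := contDiff_const.mul (hdh.clm_apply hξ)
  have hc : ContDiff ℝ ∞ c := hΩ.mul (hdh.clm_apply hη)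
  let O : Set E := {x | b x ≠ 0 ∧ 0 < b x ^ 2 - 4 * f x * c x}
  have hO : IsOpen O := (isOpen_ne_fun hb.continuous continuous_const).inter
    (isOpen_lt continuous_const ((hb.continuous.pow 2).sub
      ((continuous_const.mul hf.continuous).mul hc.continuous)))
  have hby : b y ≠ 0 := mul_ne_zero two_ne_zero htr
  have hyO : y ∈ O := by
    refine ⟨hby, ?_⟩
    have : c y = 0 := by simp [c, hΩy]
    rw [this]
    simpa using pow_pos (abs_pos.2 hby) 2
  -- The root `(-b + √(b² - 4fc)) / (2c)` (for `b > 0`) with rationalized numerator. This form stays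
  -- smooth across `c = 0`, where it equals `-f / b`.
  let s : E → ℝ := fun x => -2 * f x / (b x * (1 + √(1 - 4 * f x * c x / b x ^ 2)))
  have hpos : ∀ x ∈ O, 0 < 1 - 4 * f x * c x / b x ^ 2 := by
    intro x hx
    have hb2 : 0 < b x ^ 2 := by have := hx.1; positivity
    rw [sub_pos, div_lt_one hb2]
    linarith [hx.2]
  have hs : ContDiffOn ℝ ∞ s O := by
    have h1 : ContDiffOn ℝ ∞ (fun x => 1 - 4 * f x * c x / b x ^ 2) O :=
      contDiffOn_const.sub (((contDiff_const.mul hf).mul hc).contDiffOn.div (hb.pow 2).contDiffOn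
        fun x hx => pow_ne_zero 2 hx.1)
    refine (contDiff_const.mul hf).contDiffOn.div (hb.contDiffOn.mul (contDiffOn_const.add
      (h1.sqrt fun x hx => (hpos x hx).ne'))) fun x hx => mul_ne_zero hx.1 ?_
    positivity
  have hsroot : ∀ x ∈ O, f x + b x * s x + c x * s x ^ 2 = 0 := by
    intro x hx
    have hb0 := hx.1
    set D := √(1 - 4 * f x * c x / b x ^ 2) with hD
    have hD2 : D ^ 2 = 1 - 4 * f x * c x / b x ^ 2 := Real.sq_sqrt (hpos x hx).le
    have hD0 : 1 + D ≠ 0 := by positivity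
    have hD3 : 4 * f x * c x = (1 - D ^ 2) * b x ^ 2 := by
      rw [hD2]; field_simp; ring
    have : f x + b x * s x + c x * s x ^ 2
        = f x * (b x ^ 2 * (D ^ 2 - 1) + 4 * f x * c x) / (b x ^ 2 * (1 + D) ^ 2) := by
      simp only [s, ← hD]; field_simp; ring
    rw [this, hD3]
    ring_nf
  obtain ⟨s₁, hs₁, hse⟩ := exists_contDiff_eventuallyEq hO hs hyO
  -- Since `Ω y = 0`, the velocity at `y` is `2 ∇Ω` for any momentum, so transversality is exactly
  -- the noncharacteristic condition.
  have hs₁y : (2 : ℝ) • A y (fderiv ℝ Ω y) = v (y, s₁ y • fderiv ℝ h y) := by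
    simp [v, hΩy]
  obtain ⟨U, u, hUo, hyU, hu, huF, huh⟩ := exists_hamiltonJacobi_solution hF hv
    (hs₁.smul hdh) hh hy hFv
    (by
      filter_upwards [hse, hO.mem_nhds hyO] with x h1 h2
      rw [← hsroot x h2]
      simp only [F, b, c, Pi.smul_apply', h1, map_smul, smul_apply, smul_eq_mul]
      ring)
    (Eventually.of_forall fun x δ hδ => by simp [hδ])
    (by rw [Pi.smul_apply', ← hs₁y, map_smul]; exact mul_ne_zero two_ne_zero htr)
  obtain ⟨N, hN, hNo, hyN⟩ := eventually_nhds_iff.1 (hsymm.and hfe)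
  refine ⟨U ∩ N, fun x => Real.exp (u x), hUo.inter hNo, ⟨hyU, hyN⟩,
    (hu.mono inter_subset_left).exp, fun x _ => Real.exp_pos _, ?_, ?_⟩
  · rintro x ⟨hx, hxN⟩
    have hud : DifferentiableAt ℝ u x :=
      (hu.contDiffAt (hUo.mem_nhds hx)).differentiableAt (by simp)
    -- For `ρ = exp u` and `|dΩ|² = Ω f`, the null expression is `exp(u)² Ω F(x, du)`.
    rw [fderiv_mul_null_expand (hN x hxN).1 hud.exp (hΩ.differentiable (by simp) x),
      (hN x hxN).2, fderiv_exp hud]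
    have h1 := huF x hx
    simp only [F] at h1
    simp only [map_smul, smul_apply, smul_eq_mul]
    linear_combination (Real.exp (u x) ^ 2 * Ω x) * h1
  · rintro x ⟨hx, -⟩ hx0
    change Real.exp (u x) = 1
    rw [huh x hx hx0, Real.exp_zero]

end LocalGauge

/-! ### Local uniqueness in coordinates -/

section LocalUniqueness

variable {E : Type} [NormedAddCommGroup E] [NormedSpace ℝ E]

set_option maxSynthPendingDepth 3 in
/-- Propagation estimate: along `v = A dΩ`, the differential of a solution of
`2 ρ dρ(v) + Ω |dρ|² = 0` satisfies a linear differential inequality. -/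
theorem norm_fderiv_fderiv_apply_le {A : E → (E →L[ℝ] ℝ) →L[ℝ] E} {ρ Ω : E → ℝ} {v : E → E}
    {U : Set E} (hU : IsOpen U) (hA : ContDiff ℝ ∞ A) (hΩ : ContDiff ℝ ∞ Ω) (hv : ContDiff ℝ ∞ v)
    (hρ : ContDiffOn ℝ ∞ ρ U)
    (heq : ∀ x ∈ U, 2 * ρ x * fderiv ℝ ρ x (v x)
      + Ω x * fderiv ℝ ρ x (A x (fderiv ℝ ρ x)) = 0) {x : E} (hx : x ∈ U) :
    2 * |ρ x| * ‖fderiv ℝ (fderiv ℝ ρ) x (v x)‖ ≤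
      (2 * ‖fderiv ℝ ρ x‖ * ‖v x‖ + 2 * |ρ x| * ‖fderiv ℝ v x‖
        + ‖fderiv ℝ Ω x‖ * (‖A x‖ * ‖fderiv ℝ ρ x‖)
        + |Ω x| * (2 * (‖fderiv ℝ (fderiv ℝ ρ) x‖ * ‖A x‖)
          + ‖fderiv ℝ A x‖ * ‖fderiv ℝ ρ x‖)) * ‖fderiv ℝ ρ x‖ := by
  have hc : ContDiffAt ℝ ∞ ρ x := hρ.contDiffAt (hU.mem_nhds hx)
  have hρd : HasFDerivAt ρ (fderiv ℝ ρ x) x := (hc.differentiableAt (by simp)).hasFDerivAt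
  have hm : HasFDerivAt (fderiv ℝ ρ) (fderiv ℝ (fderiv ℝ ρ) x) x :=
    ((hc.fderiv_right (m := ∞) (by simp)).differentiableAt (by simp)).hasFDerivAt
  have hsymm : IsSymmSndFDerivAt ℝ ρ x := hc.isSymmSndFDerivAt (by
      rw [minSmoothness_of_isRCLikeNormedField]
      exact ENat.LEInfty.out)
  have hvd : HasFDerivAt v (fderiv ℝ v x) x := (hv.differentiable (by simp) x).hasFDerivAt
  have hAd : HasFDerivAt A (fderiv ℝ A x) x := (hA.differentiable (by simp) x).hasFDerivAt
  have hΩd : HasFDerivAt Ω (fderiv ℝ Ω x) x := (hΩ.differentiable (by simp) x).hasFDerivAt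
  have h1 := ((hρd.const_mul 2).mul (hm.clm_apply hvd)).add
    (hΩd.mul (hm.clm_apply (hAd.clm_apply hm)))
  have h2 : HasFDerivAt (fun x => 2 * ρ x * fderiv ℝ ρ x (v x)
      + Ω x * fderiv ℝ ρ x (A x (fderiv ℝ ρ x))) (0 : E →L[ℝ] ℝ) x :=
    (hasFDerivAt_const (0 : ℝ) x).congr_of_eventuallyEq
      (by filter_upwards [hU.mem_nhds hx] with z hz using heq z hz)
  have h3 := h2.unique h1
  set m := fderiv ℝ ρ x with hmdef
  set D := fderiv ℝ (fderiv ℝ ρ) x with hDdef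
  -- Differentiate the equation along `w` and use symmetry of `D`. Every remaining term has a factor
  -- `m = dρ`; `D` survives only as a coefficient, bounded on compact sets.
  have h4 : ∀ w, 2 * ρ x * D (v x) w = -(2 * m w * m (v x) + 2 * ρ x * m (fderiv ℝ v x w)
      + fderiv ℝ Ω x w * m (A x m) + Ω x * (D w (A x m) + (m (fderiv ℝ A x w m)
        + m (A x (D w))))) := by
    intro w
    have h5 := congrArg (fun L => L w) h3
    have h6 : D (v x) w = D w (v x) := hsymm.eq (v x) w
    simp at h5
    rw [h6]
    linear_combination -h5
  have h7 : ∀ w, ‖(2 * |ρ x|) * ‖D (v x) w‖‖ ≤ ((2 * ‖m‖ * ‖v x‖ + 2 * |ρ x| * ‖fderiv ℝ v x‖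
        + ‖fderiv ℝ Ω x‖ * (‖A x‖ * ‖m‖)
        + |Ω x| * (2 * (‖D‖ * ‖A x‖) + ‖fderiv ℝ A x‖ * ‖m‖)) * ‖m‖) * ‖w‖ := by
    intro w
    have h8 : ‖(2 * |ρ x|) * ‖D (v x) w‖‖ = ‖2 * ρ x * D (v x) w‖ := by
      simp
    have e1 : ‖m w‖ ≤ ‖m‖ * ‖w‖ := m.le_opNorm w
    have e2 : ‖m (v x)‖ ≤ ‖m‖ * ‖v x‖ := m.le_opNorm _
    have e3 : ‖m (fderiv ℝ v x w)‖ ≤ ‖m‖ * (‖fderiv ℝ v x‖ * ‖w‖) :=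
      m.le_opNorm_of_le ((fderiv ℝ v x).le_opNorm w)
    have e4 : ‖fderiv ℝ Ω x w‖ ≤ ‖fderiv ℝ Ω x‖ * ‖w‖ := (fderiv ℝ Ω x).le_opNorm w
    have e5 : ‖m (A x m)‖ ≤ ‖m‖ * (‖A x‖ * ‖m‖) := m.le_opNorm_of_le ((A x).le_opNorm m)
    have e6 : ‖D w (A x m)‖ ≤ ‖D‖ * ‖w‖ * (‖A x‖ * ‖m‖) :=
      (D w).le_of_opNorm_le_of_le (D.le_opNorm w) ((A x).le_opNorm m)
    have e7 : ‖m (fderiv ℝ A x w m)‖ ≤ ‖m‖ * (‖fderiv ℝ A x‖ * ‖w‖ * ‖m‖) :=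
      m.le_opNorm_of_le ((fderiv ℝ A x w).le_of_opNorm_le ((fderiv ℝ A x).le_opNorm w) m)
    have e8 : ‖m (A x (D w))‖ ≤ ‖m‖ * (‖A x‖ * (‖D‖ * ‖w‖)) :=
      m.le_opNorm_of_le ((A x).le_opNorm_of_le (D.le_opNorm w))
    rw [h8, h4 w, norm_neg]
    have f1 : ‖2 * m w * m (v x)‖ ≤ 2 * (‖m‖ * ‖w‖) * (‖m‖ * ‖v x‖) := by
      rw [norm_mul, norm_mul, Real.norm_two]; gcongr
    have f2 : ‖2 * ρ x * m (fderiv ℝ v x w)‖ ≤ 2 * |ρ x| * (‖m‖ * (‖fderiv ℝ v x‖ * ‖w‖)) := by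
      rw [norm_mul, norm_mul, Real.norm_two, Real.norm_eq_abs (ρ x)]; gcongr
    have f3 : ‖fderiv ℝ Ω x w * m (A x m)‖ ≤
        ‖fderiv ℝ Ω x‖ * ‖w‖ * (‖m‖ * (‖A x‖ * ‖m‖)) := by
      rw [norm_mul]; gcongr
    have f4 : ‖Ω x * (D w (A x m) + (m (fderiv ℝ A x w m) + m (A x (D w))))‖ ≤
        |Ω x| * (‖D‖ * ‖w‖ * (‖A x‖ * ‖m‖) + (‖m‖ * (‖fderiv ℝ A x‖ * ‖w‖ * ‖m‖)
          + ‖m‖ * (‖A x‖ * (‖D‖ * ‖w‖)))) := by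
      rw [norm_mul, Real.norm_eq_abs]
      exact mul_le_mul_of_nonneg_left (norm_add_le_of_le e6 (norm_add_le_of_le e7 e8))
        (abs_nonneg _)
    refine (norm_add_le_of_le (norm_add_le_of_le (norm_add_le_of_le f1 f2) f3) f4).trans
      (le_of_eq ?_)
    ring
  have h9 : ‖(2 * ρ x) • D (v x)‖ ≤ (2 * ‖m‖ * ‖v x‖ + 2 * |ρ x| * ‖fderiv ℝ v x‖
        + ‖fderiv ℝ Ω x‖ * (‖A x‖ * ‖m‖)
        + |Ω x| * (2 * (‖D‖ * ‖A x‖) + ‖fderiv ℝ A x‖ * ‖m‖)) * ‖m‖ :=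
    ContinuousLinearMap.opNorm_le_bound _ (by positivity) (fun w => by
      have := h7 w
      rw [norm_mul, norm_norm, Real.norm_of_nonneg (by positivity : 0 ≤ 2 * |ρ x|)] at this
      simpa [abs_mul, mul_assoc] using this)
  rw [norm_smul, norm_mul, Real.norm_eq_abs, Real.norm_eq_abs] at h9
  simpa using h9

variable [FiniteDimensional ℝ E]

/-- If `A dΩ` is null on `{Ω = 0}` and transverse to `{h = 0}`, then `{Ω ≠ 0}` is dense in
`{h = 0}`. -/
theorem not_eventually_zero_of_transverse {Ω h : E → ℝ} (hΩ : ContDiff ℝ ∞ Ω)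
    (hh : ContDiff ℝ ∞ h) {x ξ : E} (hx : h x = 0) (hξ : fderiv ℝ h x ξ ≠ 0)
    (hΩξ : fderiv ℝ Ω x ξ = 0) (hΩ0 : fderiv ℝ Ω x ≠ 0) :
    ¬ ∀ᶠ z in 𝓝 x, h z = 0 → Ω z = 0 := by
  intro hcon
  have hd : fderiv ℝ h x ≠ 0 := fun h0 => hξ (by rw [h0]; rfl)
  -- Vanishing on `{h = 0}` would give `dΩ = c dh`; evaluating on `ξ` forces `c = 0`, contrary to
  -- `dΩ ≠ 0`.
  obtain ⟨c, hc⟩ := exists_fderiv_eq_smul_of_vanishes hh hx hd isOpen_univ (mem_univ x)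
    hΩ.contDiffOn hcon
  rw [hc, smul_apply, smul_eq_mul, mul_eq_zero] at hΩξ
  rw [hΩξ.resolve_right hξ, zero_smul] at hc
  exact hΩ0 hc

set_option maxSynthPendingDepth 3 in
/-- Local uniqueness of the gauge, in coordinates: `ρ = 1` is the only null rescaling on suitable
small neighbourhoods. -/
theorem exists_nhds_gauge_unique {A : E → (E →L[ℝ] ℝ) →L[ℝ] E} (hA : ContDiff ℝ ∞ A)
    {Ω h : E → ℝ} (hΩ : ContDiff ℝ ∞ Ω) (hh : ContDiff ℝ ∞ h) {y : E}
    (hsymm : ∀ᶠ x in 𝓝 y, ∀ p π : E →L[ℝ] ℝ, p (A x π) = π (A x p))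
    (hΩy : Ω y = 0) (hy : h y = 0) (htr : fderiv ℝ h y (A y (fderiv ℝ Ω y)) ≠ 0)
    (hnull : ∀ᶠ x in 𝓝 y, fderiv ℝ Ω x (A x (fderiv ℝ Ω x)) = 0) {V : Set E} (hV : V ∈ 𝓝 y) :
    ∃ U : Set E, IsOpen U ∧ y ∈ U ∧ U ⊆ V ∧ ∀ ρ : E → ℝ, ContDiffOn ℝ ∞ ρ U →
      (∀ x ∈ U, ρ x ≠ 0) →
      (∀ x ∈ U, fderiv ℝ (fun z => ρ z * Ω z) x (A x (fderiv ℝ (fun z => ρ z * Ω z) x)) = 0) →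
      (∀ x ∈ U, h x = 0 → ρ x * Ω x = Ω x) → ∀ x ∈ U, ρ x = 1 := by
  have hdΩ : ContDiff ℝ ∞ (fderiv ℝ Ω) := hΩ.fderiv_right (m := ∞) (by simp)
  have hdh : ContDiff ℝ ∞ (fderiv ℝ h) := hh.fderiv_right (m := ∞) (by simp)
  set v : E → E := fun x => A x (fderiv ℝ Ω x) with hvdef
  have hv : ContDiff ℝ ∞ v := contDiff_inverseMetric_apply hA hΩ
  have htr' : ∀ᶠ x in 𝓝 y, fderiv ℝ h x (v x) ≠ 0 :=
    (hdh.clm_apply hv).continuous.continuousAt.eventually_ne htr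
  have hN := inter_mem hV ((hsymm.and hnull).and htr')
  obtain ⟨U, hUo, hyU, hUN, hUc, hUγ⟩ := exists_flowBox hv hh hy htr hN
  refine ⟨U, hUo, hyU, fun x hx => (hUN hx).1, fun ρ hρ hρ0 hρn hρi => ?_⟩
  have hsy : ∀ x ∈ U, ∀ p π : E →L[ℝ] ℝ, p (A x π) = π (A x p) := fun x hx => (hUN hx).2.1.1
  have hnu : ∀ x ∈ U, fderiv ℝ Ω x (v x) = 0 := fun x hx => (hUN hx).2.1.2
  have hhv : ∀ x ∈ U, fderiv ℝ h x (v x) ≠ 0 := fun x hx => (hUN hx).2.2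
  have hdΩ0 : ∀ x ∈ U, fderiv ℝ Ω x ≠ 0 := fun x hx h0 =>
    hhv x hx (by simp [hvdef, h0])
  have hdh0 : ∀ x ∈ U, fderiv ℝ h x ≠ 0 := fun x hx h0 => hhv x hx (by rw [h0]; rfl)
  have hρc : ContinuousOn ρ U := hρ.continuousOn
  have hmc : ContinuousOn (fderiv ℝ ρ) U := hρ.continuousOn_fderiv_of_isOpen hUo (by simp)
  have hAc : ContinuousOn A U := hA.continuous.continuousOn
  have hvc : ContinuousOn v U := hv.continuous.continuousOn
  have hΩc : ContinuousOn Ω U := hΩ.continuous.continuousOn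
  -- the reduced equation, first off the zero set of `Ω` and then by density
  have heq : ∀ x ∈ U, 2 * ρ x * fderiv ℝ ρ x (v x)
      + Ω x * fderiv ℝ ρ x (A x (fderiv ℝ ρ x)) = 0 := by
    have hoff : ∀ x ∈ U, Ω x ≠ 0 → 2 * ρ x * fderiv ℝ ρ x (v x)
        + Ω x * fderiv ℝ ρ x (A x (fderiv ℝ ρ x)) = 0 := by
      intro x hx hx0
      have h1 := hρn x hx
      rw [fderiv_mul_null_expand (hsy x hx)
        ((hρ.contDiffAt (hUo.mem_nhds hx)).differentiableAt (by simp))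
        (hΩ.differentiable (by simp) x), show fderiv ℝ Ω x (A x (fderiv ℝ Ω x)) = 0 from hnu x hx,
        mul_zero, zero_add] at h1
      exact (mul_eq_zero.1 h1).resolve_left hx0
    intro x hx
    by_contra hne
    have hcont : ContinuousOn (fun x => 2 * ρ x * fderiv ℝ ρ x (v x)
      + Ω x * fderiv ℝ ρ x (A x (fderiv ℝ ρ x))) U :=
      ((continuousOn_const.mul hρc).mul (hmc.clm_apply hvc)).add
        (hΩc.mul (hmc.clm_apply (hAc.clm_apply hmc)))
    have h1 := (hcont.continuousAt (hUo.mem_nhds hx)).eventually_ne hne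
    have h2 : Ω =ᶠ[𝓝 x] fun _ => 0 := by
      filter_upwards [h1, hUo.mem_nhds hx] with z hz hzU
      by_contra hz0
      exact hz (hoff z hzU hz0)
    exact hdΩ0 x hx (by rw [h2.fderiv_eq]; simp)
  -- `ρ = 1` on the initial surface
  have hρ1 : ∀ x ∈ U, h x = 0 → ρ x = 1 := by
    intro x hx hx0
    by_contra hne
    -- The data give only `(ρ - 1) Ω = 0` on the surface, so `ρ ≠ 1` near a point would make `Ω`
    -- vanish on the surface there.
    refine not_eventually_zero_of_transverse hΩ hh hx0 (hhv x hx) (hnu x hx) (hdΩ0 x hx) ?_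
    filter_upwards [(hρc.continuousAt (hUo.mem_nhds hx)).eventually_ne hne, hUo.mem_nhds hx]
      with z hz hzU hz0
    have h1 := hρi z hzU hz0
    have h2 : (ρ z - 1) * Ω z = 0 := by linear_combination h1
    exact (mul_eq_zero.1 h2).resolve_left (sub_ne_zero.2 hz)
  have hσ : ∀ x ∈ U, h x = 0 → ∃ c : ℝ, fderiv ℝ ρ x = c • fderiv ℝ h x := by
    intro x hx hx0
    obtain ⟨c, hc⟩ := exists_fderiv_eq_smul_of_vanishes hh hx0 (hdh0 x hx) hUo hx
      (hρ.sub contDiffOn_const (f := ρ) (g := fun _ => (1 : ℝ)))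
      (by filter_upwards [hUo.mem_nhds hx] with z hz hz0; rw [hρ1 z hz hz0, sub_self])
    exact ⟨c, by rw [← hc, fderiv_sub_const]⟩
  -- `dρ = 0` on the initial surface, by connectedness
  let q : E → ℝ := fun x => Ω x * (fderiv ℝ ρ x (v x) / fderiv ℝ h x (v x))
  let ε : E → ℝ := fun x => q x * fderiv ℝ h x (A x (fderiv ℝ h x)) + 2 * fderiv ℝ h x (v x)
  have hqc : ContinuousOn q U := hΩc.mul ((hmc.clm_apply hvc).div
    (hdh.continuous.continuousOn.clm_apply hvc) hhv)
  have hεc : ContinuousOn ε U :=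
    (hqc.mul (hdh.continuous.continuousOn.clm_apply (hAc.clm_apply hdh.continuous.continuousOn))).add
      (continuousOn_const.mul (hdh.continuous.continuousOn.clm_apply hvc))
  -- On the surface `dρ = c dh` and `q = Ω c`, so the equation reads `c ε = 0`. Defining `q` as a
  -- quotient makes it continuous without choosing `c`.
  have halt : ∀ x ∈ U ∩ {x | h x = 0}, fderiv ℝ ρ x = 0 ∨ ε x = 0 := by
    rintro x ⟨hx, hx0⟩
    obtain ⟨c, hc⟩ := hσ x hx hx0
    have hqx : q x = Ω x * c := by
      simp only [q, hc, smul_apply, smul_eq_mul]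
      rw [mul_div_cancel_right₀ _ (hhv x hx)]
    have h1 := heq x hx
    rw [hρ1 x hx hx0, hc] at h1
    simp only [map_smul, smul_apply, smul_eq_mul] at h1
    have h2 : c * ε x = 0 := by
      simp only [ε, hqx]
      linear_combination h1
    rcases mul_eq_zero.1 h2 with h3 | h3
    · left; rw [hc, h3, zero_smul]
    · right; exact h3
  have hqε : ∀ x ∈ U, q x = 0 → ε x ≠ 0 := by
    intro x hx hqx
    simp only [ε, hqx, zero_mul, zero_add]
    exact mul_ne_zero two_ne_zero (hhv x hx)
  have hq0 : ∀ x ∈ U ∩ {x | h x = 0}, q x = 0 := by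
    -- On the surface the open sets `ε ≠ 0` and `q ≠ 0` cover and are disjoint. The first contains
    -- `y`, where `Ω = 0`, so connectedness empties the second and excludes the nonzero root.
    have hcover : U ∩ {x | h x = 0} ⊆ U ∩ ε ⁻¹' {0}ᶜ ∪ U ∩ q ⁻¹' {0}ᶜ := by
      intro x hx
      by_cases hqx : q x = 0
      · exact Or.inl ⟨hx.1, hqε x hx.1 hqx⟩
      · exact Or.inr ⟨hx.1, hqx⟩
    by_contra! hcon
    obtain ⟨x, hx, hqx⟩ := hcon
    obtain ⟨z, hz, hz1, hz2⟩ := hUc _ _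
      (hεc.isOpen_inter_preimage hUo isOpen_compl_singleton)
      (hqc.isOpen_inter_preimage hUo isOpen_compl_singleton) hcover
      ⟨y, ⟨hyU, hy⟩, hyU, hqε y hyU (by simp [q, hΩy])⟩ ⟨x, hx, hx.1, hqx⟩
    rcases halt z hz with h3 | h3
    · exact hz2.2 (by simp [q, h3])
    · exact hz1.2 h3
  have hm0 : ∀ x ∈ U ∩ {x | h x = 0}, fderiv ℝ ρ x = 0 := fun x hx =>
    (halt x hx).resolve_right (hqε x hx.1 (hq0 x hx))
  -- propagation along the flow box
  intro x hx
  obtain ⟨τ, γ, hγ0, hγτ, hγ⟩ := hUγ x hx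
  have hmd : ∀ z ∈ U, HasFDerivAt (fderiv ℝ ρ) (fderiv ℝ (fderiv ℝ ρ) z) z := fun z hz =>
    (((hρ.contDiffAt (hUo.mem_nhds hz)).fderiv_right (m := ∞) (by simp)).differentiableAt
      (by simp)).hasFDerivAt
  have hDc : ContinuousOn (fderiv ℝ (fderiv ℝ ρ)) U :=
    (hρ.fderiv_of_isOpen (m := ∞) hUo (by simp)).continuousOn_fderiv_of_isOpen hUo (by simp)
  let κ : E → ℝ := fun x => (2 * ‖fderiv ℝ ρ x‖ * ‖v x‖ + 2 * |ρ x| * ‖fderiv ℝ v x‖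
        + ‖fderiv ℝ Ω x‖ * (‖A x‖ * ‖fderiv ℝ ρ x‖)
        + |Ω x| * (2 * (‖fderiv ℝ (fderiv ℝ ρ) x‖ * ‖A x‖)
          + ‖fderiv ℝ A x‖ * ‖fderiv ℝ ρ x‖)) / (2 * |ρ x|)
  have hκc : ContinuousOn κ U := by
    have hdv : ContinuousOn (fderiv ℝ v) U :=
      (hv.continuous_fderiv (by simp)).continuousOn
    have hdA : ContinuousOn (fderiv ℝ A) U :=
      (hA.continuous_fderiv (by simp)).continuousOn
    have hdΩc : ContinuousOn (fderiv ℝ Ω) U := hdΩ.continuous.continuousOn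
    refine ContinuousOn.div (by fun_prop) (by fun_prop) fun z hz => ?_
    exact mul_ne_zero two_ne_zero (abs_ne_zero.2 (hρ0 z hz))
  have hκ : ∀ z ∈ U, ‖fderiv ℝ (fderiv ℝ ρ) z (v z)‖ ≤ κ z * ‖fderiv ℝ ρ z‖ := by
    intro z hz
    have h1 := norm_fderiv_fderiv_apply_le hUo hA hΩ hv hρ heq hz
    have h2 : 0 < 2 * |ρ z| := mul_pos two_pos (abs_pos.2 (hρ0 z hz))
    rw [div_mul_eq_mul_div, le_div_iff₀ h2, mul_comm]
    exact h1
  have hγc : ContinuousOn (fun t => κ (γ t)) (uIcc 0 τ) :=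
    hκc.comp (fun t ht => (hγ t ht).2.continuousAt.continuousWithinAt) fun t ht => (hγ t ht).1
  -- The coefficient `κ` depends on `ρ`, but only its boundedness along this one compact orbit is
  -- needed.
  obtain ⟨C, hC⟩ := isCompact_uIcc.exists_bound_of_continuousOn hγc
  have hmγ : ∀ t ∈ uIcc 0 τ, fderiv ℝ ρ (γ t) = 0 := by
    intro t ht
    have hsub : uIcc 0 t ⊆ uIcc 0 τ := uIcc_subset_uIcc_left ht
    refine eq_zero_of_norm_deriv_le (f := fun s => fderiv ℝ ρ (γ s))
      (f' := fun s => fderiv ℝ (fderiv ℝ ρ) (γ s) (v (γ s))) (C := C)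
      (fun s hs => ?_) (fun s hs => ?_) (hm0 _ hγ0)
    · exact (hmd _ (hγ s (hsub hs)).1).comp_hasDerivAt s (hγ s (hsub hs)).2
    · refine (hκ _ (hγ s (hsub hs)).1).trans (mul_le_mul_of_nonneg_right ?_ (norm_nonneg _))
      exact (le_abs_self _).trans (hC s (hsub hs))
  have hconst := eq_of_hasDerivAt_zero (convex_uIcc 0 τ) (f := fun t => ρ (γ t))
    (fun t ht => by
      have h1 := ((hρ.contDiffAt (hUo.mem_nhds (hγ t ht).1)).differentiableAt
        (by simp)).hasFDerivAt.comp_hasDerivAt t (hγ t ht).2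
      rw [hmγ t ht] at h1
      exact h1) left_mem_uIcc right_mem_uIcc
  change ρ (γ τ) = ρ (γ 0) at hconst
  rw [← hγτ, hconst, hρ1 _ hγ0.1 hγ0.2]

end LocalUniqueness

/-! ### Inverting nondegenerate bilinear forms -/

section Inverse

variable {V : Type*} [AddCommGroup V] [Module ℝ V] [TopologicalSpace V]

theorem apply_inverse_of_isInvertible {G : V →L[ℝ] V →L[ℝ] ℝ} (hG : G.IsInvertible)
    (α : V →L[ℝ] ℝ) : G (G.inverse α) = α := by
  obtain ⟨e, rfl⟩ := hG
  rw [ContinuousLinearMap.inverse_equiv]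
  exact e.apply_symm_apply α

theorem inverse_apply_of_isInvertible {G : V →L[ℝ] V →L[ℝ] ℝ} (hG : G.IsInvertible)
    (v : V) : G.inverse (G v) = v := by
  obtain ⟨e, rfl⟩ := hG
  rw [ContinuousLinearMap.inverse_equiv]
  exact e.symm_apply_apply v

end Inverse

section Nondegenerate

variable {V : Type*} [AddCommGroup V] [Module ℝ V] [TopologicalSpace V] [IsTopologicalAddGroup V]
  [ContinuousSMul ℝ V] [T2Space V] [FiniteDimensional ℝ V]

/-- A nondegenerate bilinear form on a finite-dimensional space identifies it with its dual. -/
theorem isInvertible_of_nondegenerate {G : V →L[ℝ] V →L[ℝ] ℝ}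
    (hG : ∀ v, (∀ w, G v w = 0) → v = 0) : G.IsInvertible := by
  have hdim : Module.finrank ℝ V = Module.finrank ℝ (V →L[ℝ] ℝ) := by
    rw [← (LinearMap.toContinuousLinearMap : (V →ₗ[ℝ] ℝ) ≃ₗ[ℝ] (V →L[ℝ] ℝ)).finrank_eq]
    exact Subspace.dual_finrank_eq.symm
  have : FiniteDimensional ℝ (V →L[ℝ] ℝ) :=
    Module.Finite.equiv (LinearMap.toContinuousLinearMap : (V →ₗ[ℝ] ℝ) ≃ₗ[ℝ] (V →L[ℝ] ℝ))
  have hinj : Function.Injective (G : V →ₗ[ℝ] V →L[ℝ] ℝ) := by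
    rw [← LinearMap.ker_eq_bot, LinearMap.ker_eq_bot']
    intro v hv
    refine hG v fun w => ?_
    change ((G : V →ₗ[ℝ] V →L[ℝ] ℝ) v) w = 0
    rw [hv]; rfl
  refine ⟨(LinearEquiv.ofInjectiveOfFinrankEq (G : V →ₗ[ℝ] V →L[ℝ] ℝ) hinj hdim
    ).toContinuousLinearEquiv, ?_⟩
  ext; rfl

end Nondegenerate

/-! ### The metric in a chart -/

section Charts

variable {d : ℕ} {M : Type*} [TopologicalSpace M] [ChartedSpace (Model d) M]

instance (p : M) : T2Space (TangentSpace (𝓡 d) p) := inferInstanceAs (T2Space (Model d))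

instance (p : M) : FiniteDimensional ℝ (TangentSpace (𝓡 d) p) :=
  inferInstanceAs (FiniteDimensional ℝ (Model d))

/-- The differential of the inverse of the chart around `p`. -/
noncomputable def chartSymmDeriv (p : M) (y : Model d) :
    Model d →L[ℝ] TangentSpace (𝓡 d) ((extChartAt (𝓡 d) p).symm y) :=
  mfderiv 𝓘(ℝ, Model d) (𝓡 d) (extChartAt (𝓡 d) p).symm y

/-- The metric in the chart around `p`. -/
noncomputable def chartMetric (g : BilinField d M) (p : M) (y : Model d) :
    Model d →L[ℝ] Model d →L[ℝ] ℝ :=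
  (ContinuousLinearMap.compL ℝ (Model d) (Model d) ℝ).flip (chartSymmDeriv p y) ∘L
    (g ((extChartAt (𝓡 d) p).symm y) ∘L chartSymmDeriv p y)

theorem chartMetric_apply (g : BilinField d M) (p : M) (y v w : Model d) :
    chartMetric g p y v w = g ((extChartAt (𝓡 d) p).symm y) (chartSymmDeriv p y v)
      (chartSymmDeriv p y w) := rfl

/-- The inverse metric in the chart around `p`. -/
noncomputable def chartInverseMetric (g : BilinField d M) (p : M) (y : Model d) :
    (Model d →L[ℝ] ℝ) →L[ℝ] Model d :=
  (chartMetric g p y).inverse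

theorem isManifold_one [h : IsManifold (𝓡 d) ∞ M] : IsManifold (𝓡 d) 1 M :=
  IsManifold.of_le (n := ∞) (by simp)

variable [IsManifold (𝓡 d) ∞ M] {g : BilinField d M}

theorem IsSemiRiemannian.isInvertible (hg : IsSemiRiemannian g) (q : M) : (g q).IsInvertible :=
  isInvertible_of_nondegenerate (hg.nondegenerate q)

theorem IsSemiRiemannian.apply_grad (hg : IsSemiRiemannian g) (f : M → ℝ) (q : M) :
    g q (grad g f q) = differential f q :=
  apply_inverse_of_isInvertible (hg.isInvertible q) _

theorem IsSemiRiemannian.gradNormSq_eq (hg : IsSemiRiemannian g) (f : M → ℝ) (q : M) :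
    gradNormSq g f q = differential f q (grad g f q) := by
  rw [gradNormSq, hg.apply_grad]

variable {p : M} {y : Model d}

theorem mdifferentiableAt_chart_symm (hy : y ∈ (extChartAt (𝓡 d) p).target) :
    MDifferentiableAt 𝓘(ℝ, Model d) (𝓡 d) (extChartAt (𝓡 d) p).symm y :=
  ((contMDiffOn_extChartAt_symm (n := ∞) p).contMDiffAt
    ((isOpen_extChartAt_target p).mem_nhds hy)).mdifferentiableAt (by simp)

theorem chartSymmDeriv_isInvertible (hy : y ∈ (extChartAt (𝓡 d) p).target) :
    (chartSymmDeriv p y).IsInvertible := by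
  have := isManifold_one (M := M) (d := d)
  have h := isInvertible_mfderivWithin_extChartAt_symm (I := 𝓡 d) (x := p) hy
  rw [modelWithCornersSelf_coe, range_id, mfderivWithin_univ] at h
  exact h

theorem fderiv_comp_chart_symm {f : M → ℝ} (hy : y ∈ (extChartAt (𝓡 d) p).target)
    (hf : MDifferentiableAt (𝓡 d) 𝓘(ℝ, ℝ) f ((extChartAt (𝓡 d) p).symm y)) (v : Model d) :
    fderiv ℝ (fun z => f ((extChartAt (𝓡 d) p).symm z)) y v =
      differential f ((extChartAt (𝓡 d) p).symm y) (chartSymmDeriv p y v) := by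
  have h := mfderiv_comp y hf (mdifferentiableAt_chart_symm hy)
  rw [mfderiv_eq_fderiv] at h
  exact congrArg (fun L : Model d →L[ℝ] ℝ => L v) h

theorem chartMetric_isInvertible (hg : IsSemiRiemannian g)
    (hy : y ∈ (extChartAt (𝓡 d) p).target) : (chartMetric g p y).IsInvertible := by
  obtain ⟨e, he⟩ := chartSymmDeriv_isInvertible hy
  refine isInvertible_of_nondegenerate fun v hv => ?_
  have h1 : chartSymmDeriv p y v = 0 := by
    refine hg.nondegenerate _ _ fun w => ?_
    have h2 := hv (e.symm w)
    rw [chartMetric_apply] at h2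
    have h3 : chartSymmDeriv p y (e.symm w) = w := by
      rw [← he]; exact e.apply_symm_apply w
    rwa [h3] at h2
  rw [← he] at h1
  exact e.map_eq_zero_iff.1 h1

theorem chartInverseMetric_symm (hg : IsSemiRiemannian g)
    (hy : y ∈ (extChartAt (𝓡 d) p).target) (α β : Model d →L[ℝ] ℝ) :
    α (chartInverseMetric g p y β) = β (chartInverseMetric g p y α) := by
  have hi := chartMetric_isInvertible hg hy
  conv_lhs => rw [← apply_inverse_of_isInvertible hi α]
  conv_rhs => rw [← apply_inverse_of_isInvertible hi β]
  rw [chartMetric_apply, chartMetric_apply, hg.symm]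
  rfl

/-- The chart metric is the pullback of `g`, so the gradients correspond under `chartSymmDeriv`.
Taking `k = f` gives the gradient norm; taking `k` a function vanishing on `H` gives the
transversality pairing. -/
theorem fderiv_chartInverseMetric (hg : IsSemiRiemannian g)
    (hy : y ∈ (extChartAt (𝓡 d) p).target) {f k : M → ℝ}
    (hf : MDifferentiableAt (𝓡 d) 𝓘(ℝ, ℝ) f ((extChartAt (𝓡 d) p).symm y))
    (hk : MDifferentiableAt (𝓡 d) 𝓘(ℝ, ℝ) k ((extChartAt (𝓡 d) p).symm y)) :
    fderiv ℝ (fun z => k ((extChartAt (𝓡 d) p).symm z)) y (chartInverseMetric g p y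
      (fderiv ℝ (fun z => f ((extChartAt (𝓡 d) p).symm z)) y)) =
      differential k ((extChartAt (𝓡 d) p).symm y) (grad g f ((extChartAt (𝓡 d) p).symm y)) := by
  obtain ⟨e, he⟩ := chartSymmDeriv_isInvertible hy
  have h1 : chartSymmDeriv p y (e.symm (grad g f _)) = grad g f _ := by
    rw [← he]; exact e.apply_symm_apply _
  have h2 : fderiv ℝ (fun z => f ((extChartAt (𝓡 d) p).symm z)) y =
      chartMetric g p y (e.symm (grad g f _)) := by
    ext v
    rw [fderiv_comp_chart_symm hy hf, chartMetric_apply, h1, hg.apply_grad]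
  rw [h2, chartInverseMetric, inverse_apply_of_isInvertible (chartMetric_isInvertible hg hy),
    fderiv_comp_chart_symm hy hk, h1]

/-- Smoothness of `g` is that of a bundle section. It is tested on constant vectors, whose images
under the tangent map of the inverse chart are smooth fields. -/
theorem contDiffOn_chartMetric (hg : IsSemiRiemannian g) (p : M) :
    ContDiffOn ℝ ∞ (chartMetric g p) (extChartAt (𝓡 d) p).target := by
  have := isManifold_one (M := M) (d := d)
  set t := (extChartAt (𝓡 d) p).target with ht
  have hto : IsOpen t := isOpen_extChartAt_target p
  have hsymm : ContMDiffOn 𝓘(ℝ, Model d) (𝓡 d) ∞ (extChartAt (𝓡 d) p).symm t :=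
    contMDiffOn_extChartAt_symm p
  have hvec : ∀ v : Model d, ContMDiffOn 𝓘(ℝ, Model d) (𝓡 d).tangent ∞
      (fun y => (⟨(extChartAt (𝓡 d) p).symm y, chartSymmDeriv p y v⟩ : TangentBundle (𝓡 d) M)) t := by
    intro v
    have h1 : ContMDiffOn 𝓘(ℝ, Model d) 𝓘(ℝ, Model d).tangent ∞
        (fun y : Model d => (⟨y, v⟩ : TangentBundle 𝓘(ℝ, Model d) (Model d))) t :=
      contMDiffOn_vectorSpace_iff_contDiffOn.2 contDiffOn_const
    have h2 := (hsymm.contMDiffOn_tangentMapWithin (m := ∞) (by simp) hto.uniqueMDiffOn).comp h1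
      fun y hy => hy
    refine h2.congr fun y hy => ?_
    simp only [Function.comp_apply, tangentMapWithin, chartSymmDeriv]
    rw [mfderivWithin_of_isOpen hto hy]
    rfl
  refine contDiffOn_clm_apply.2 fun v => contDiffOn_clm_apply.2 fun w => ?_
  rw [← contMDiffOn_iff_contDiffOn]
  intro y hy
  have h3 : ContMDiffWithinAt 𝓘(ℝ, Model d) ((𝓡 d).prod 𝓘(ℝ)) ∞
      (fun y => Bundle.TotalSpace.mk' ℝ (E := Bundle.Trivial M ℝ) ((extChartAt (𝓡 d) p).symm y)
        (g ((extChartAt (𝓡 d) p).symm y) (chartSymmDeriv p y v) (chartSymmDeriv p y w))) t y := by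
    apply ContMDiffWithinAt.clm_bundle_apply₂ (F₁ := Model d) (F₂ := Model d)
    · exact ContMDiffAt.comp_contMDiffWithinAt y (hg.smooth.contMDiffAt) (hsymm y hy)
    · exact hvec v y hy
    · exact hvec w y hy
  simp only [Bundle.contMDiffWithinAt_totalSpace] at h3
  exact h3.2

theorem contDiffOn_chartInverseMetric (hg : IsSemiRiemannian g) (p : M) :
    ContDiffOn ℝ ∞ (chartInverseMetric g p) (extChartAt (𝓡 d) p).target := fun y hy =>
  (chartMetric_isInvertible hg hy).contDiffAt_map_inverse.comp_contDiffWithinAt y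
    (contDiffOn_chartMetric hg p y hy)

end Charts

/-! ### Local existence and uniqueness on the manifold -/

section LocalTheory

variable {d : ℕ} {M : Type*} [TopologicalSpace M] [ChartedSpace (Model d) M]

/-- A solution of the gauge conditions on an open set. -/
structure IsLocalGauge (g : BilinField d M) (Ω : M → ℝ) (H : Set M) (ω₀ : H → ℝ)
    (U : Set M) (w : M → ℝ) : Prop where
  isOpen : IsOpen U
  smooth : ContMDiffOn (𝓡 d) 𝓘(ℝ, ℝ) ∞ w U
  ne_zero : ∀ p ∈ U, w p ≠ 0
  gradNormSq_eq_zero : ∀ p ∈ U, gradNormSq (rescale w g) (fun q ↦ w q * Ω q) p = 0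
  initial : ∀ q : H, (q : M) ∈ U → w q * Ω q = ω₀ q * Ω q

theorem IsGauge.isLocalGauge {g : BilinField d M} {Ω : M → ℝ} {H : Set M} {ω₀ : H → ℝ}
    {U : Set M} {w : M → ℝ} (h : IsGauge g Ω H ω₀ U w) : IsLocalGauge g Ω H ω₀ U w :=
  ⟨h.isOpen, h.smooth, h.ne_zero, h.gradNormSq_eq_zero, h.initial⟩

theorem IsLocalGauge.mono {g : BilinField d M} {Ω : M → ℝ} {H : Set M} {ω₀ : H → ℝ}
    {U V : Set M} {w : M → ℝ} (h : IsLocalGauge g Ω H ω₀ U w) (hV : IsOpen V) (hVU : V ⊆ U) :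
    IsLocalGauge g Ω H ω₀ V w :=
  ⟨hV, h.smooth.mono hVU, fun p hp => h.ne_zero p (hVU hp),
    fun p hp => h.gradNormSq_eq_zero p (hVU hp), fun q hq => h.initial q (hVU hq)⟩

theorem differential_congr {f k : M → ℝ} {q : M} (h : f =ᶠ[𝓝 q] k) :
    differential (d := d) f q = differential k q :=
  h.mfderiv_eq

theorem gradNormSq_congr {g g' : BilinField d M} {f k : M → ℝ} {q : M} (hg : g q = g' q)
    (h : f =ᶠ[𝓝 q] k) : gradNormSq g f q = gradNormSq g' k q := by
  simp only [gradNormSq, grad, hg, differential_congr h]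

theorem IsLocalGauge.congr {g : BilinField d M} {Ω : M → ℝ} {H : Set M} {ω₀ : H → ℝ}
    {U : Set M} {w w' : M → ℝ} (h : IsLocalGauge g Ω H ω₀ U w) (hw : EqOn w' w U) :
    IsLocalGauge g Ω H ω₀ U w' := by
  refine ⟨h.isOpen, h.smooth.congr hw, fun p hp => ?_, fun p hp => ?_, fun q hq => ?_⟩
  · rw [hw hp]; exact h.ne_zero p hp
  · rw [← h.gradNormSq_eq_zero p hp]
    refine gradNormSq_congr (by simp only [rescale, hw hp]) ?_
    filter_upwards [h.isOpen.mem_nhds hp] with z hz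
    rw [hw hz]
  · rw [hw hq]; exact h.initial q hq

/-- On `𝒥` the term `2 𝔰 Ω` drops out of `λ`, curvature included; only the nullity of `∇Ω` is kept
from the hypothesis on `λ`. -/
theorem gradNormSq_eq_zero_of_lam {g : BilinField d M} {Ω : M → ℝ}
    (hlam : ∀ p ∈ scri Ω, lam g Ω p = 0) {q : M} (hq : Ω q = 0) :
    gradNormSq g Ω q = 0 := by
  have := hlam q hq
  simp only [lam, hq, mul_zero, zero_sub, neg_eq_zero] at this
  exact this

theorem isOpen_chart_preimage (p : M) {G : Set (Model d)} (hG : IsOpen G) :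
    IsOpen ((extChartAt (𝓡 d) p).source ∩ extChartAt (𝓡 d) p ⁻¹' G) :=
  (continuousOn_extChartAt p).isOpen_inter_preimage (isOpen_extChartAt_source p) hG

variable [IsManifold (𝓡 d) ∞ M] {g : BilinField d M} {Ω : M → ℝ} {H : Set M} {ω₀ : H → ℝ}

/-- The inverse metric scales by `w⁻²`, so the null condition may be tested with the original `g`.
-/
theorem IsSemiRiemannian.gradNormSq_rescale_eq_zero_iff (hg : IsSemiRiemannian g) {w f : M → ℝ}
    {q : M} (hw : w q ≠ 0) : gradNormSq (rescale w g) f q = 0 ↔ gradNormSq g f q = 0 := by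
  have hc : w q ^ 2 ≠ 0 := pow_ne_zero 2 hw
  have hi : (rescale w g q).IsInvertible := by
    refine isInvertible_of_nondegenerate fun v hv => hg.nondegenerate q v fun u => ?_
    exact (mul_eq_zero.1 (hv u)).resolve_left hc
  set a := grad (rescale w g) f q with ha
  have h1 : rescale w g q a = differential f q := apply_inverse_of_isInvertible hi _
  have h2 : grad g f q = (w q ^ 2) • a := by
    rw [grad, ← h1]
    have h3 : rescale w g q a = g q ((w q ^ 2) • a) := by rw [map_smul]; rfl
    rw [h3, inverse_apply_of_isInvertible (hg.isInvertible q)]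
  have h4 : gradNormSq (rescale w g) f q = w q ^ 2 * g q a a := rfl
  rw [h4, gradNormSq, h2]
  simp only [map_smul, smul_apply, smul_eq_mul]
  simp [hw]

variable {p : M}

/-- The coordinate theorems take data smooth on all of the model space; cutting off leaves the germ
at `p` unchanged. -/
theorem exists_contDiff_eq_comp_chart_symm {f : M → ℝ} {U : Set M} (hU : IsOpen U) (hp : p ∈ U)
    (hf : ContMDiffOn (𝓡 d) 𝓘(ℝ, ℝ) ∞ f U) :
    ∃ f₁ : Model d → ℝ, ContDiff ℝ ∞ f₁ ∧
      ∀ᶠ z in 𝓝 (extChartAt (𝓡 d) p p), f₁ z = f ((extChartAt (𝓡 d) p).symm z) := by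
  have hto := isOpen_extChartAt_target (I := 𝓡 d) p
  have hO : IsOpen ((extChartAt (𝓡 d) p).target ∩ (extChartAt (𝓡 d) p).symm ⁻¹' U) :=
    (continuousOn_extChartAt_symm p).isOpen_inter_preimage hto hU
  have hsm : ContDiffOn ℝ ∞ (fun z => f ((extChartAt (𝓡 d) p).symm z))
      ((extChartAt (𝓡 d) p).target ∩ (extChartAt (𝓡 d) p).symm ⁻¹' U) := by
    rw [← contMDiffOn_iff_contDiffOn]
    exact hf.comp ((contMDiffOn_extChartAt_symm p).mono inter_subset_left) fun z hz => hz.2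
  exact exists_contDiff_eventuallyEq hO hsm ⟨mem_extChartAt_target p, by simpa using hp⟩

theorem gradNormSq_chart (hg : IsSemiRiemannian g) {z : Model d}
    (hz : z ∈ (extChartAt (𝓡 d) p).target) {f : M → ℝ} {f₁ : Model d → ℝ}
    (hf : MDifferentiableAt (𝓡 d) 𝓘(ℝ, ℝ) f ((extChartAt (𝓡 d) p).symm z))
    (hff : f₁ =ᶠ[𝓝 z] fun z => f ((extChartAt (𝓡 d) p).symm z)) :
    gradNormSq g f ((extChartAt (𝓡 d) p).symm z) =
      fderiv ℝ f₁ z (chartInverseMetric g p z (fderiv ℝ f₁ z)) := by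
  rw [hff.fderiv_eq, fderiv_chartInverseMetric hg hz hf hf, hg.gradNormSq_eq]

/-- Coordinate expressions of the data near a point of `𝒥 ∩ H`, extended to all of `ℝ^d`. -/
theorem exists_chart_data (hgΩ : IsConformalManifold g Ω) (hH : IsHypersurface d H)
    (hHtrans : IsTransverseToScri g Ω H) (hp : p ∈ scri Ω ∩ H) :
    ∃ (G : Set (Model d)) (A₁ : Model d → (Model d →L[ℝ] ℝ) →L[ℝ] Model d) (Ω₁ h₁ : Model d → ℝ),
      IsOpen G ∧ extChartAt (𝓡 d) p p ∈ G ∧ G ⊆ (extChartAt (𝓡 d) p).target ∧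
      ContDiff ℝ ∞ A₁ ∧ ContDiff ℝ ∞ Ω₁ ∧ ContDiff ℝ ∞ h₁ ∧
      (∀ z ∈ G, A₁ z = chartInverseMetric g p z) ∧
      (∀ z ∈ G, Ω₁ z = Ω ((extChartAt (𝓡 d) p).symm z)) ∧
      (∀ z ∈ G, h₁ z = 0 ↔ (extChartAt (𝓡 d) p).symm z ∈ H) ∧
      fderiv ℝ h₁ (extChartAt (𝓡 d) p p) (A₁ (extChartAt (𝓡 d) p p)
        (fderiv ℝ Ω₁ (extChartAt (𝓡 d) p p))) ≠ 0 := by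
  have hg := hgΩ.metric
  set y := extChartAt (𝓡 d) p p with hy
  have hyt : y ∈ (extChartAt (𝓡 d) p).target := mem_extChartAt_target p
  have hyp : (extChartAt (𝓡 d) p).symm y = p := extChartAt_to_inv p
  have hto := isOpen_extChartAt_target (I := 𝓡 d) p
  obtain ⟨A₁, hA₁, hA₁e⟩ :=
    exists_contDiff_eventuallyEq hto (contDiffOn_chartInverseMetric hg p) hyt
  obtain ⟨Ω₁, hΩ₁, hΩ₁e⟩ :=
    exists_contDiff_eq_comp_chart_symm (p := p) isOpen_univ (mem_univ p) hgΩ.smooth.contMDiffOn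
  obtain ⟨Uh, h, hUho, hpUh, hh, hdh, hhH⟩ := hH p hp.2
  obtain ⟨h₁, hh₁, hh₁e⟩ := exists_contDiff_eq_comp_chart_symm hUho hpUh hh
  have hpre : ∀ᶠ z in 𝓝 y, (extChartAt (𝓡 d) p).symm z ∈ Uh := by
    have hc : ContinuousAt (extChartAt (𝓡 d) p).symm y := continuousAt_extChartAt_symm p
    exact hc.preimage_mem_nhds (by rw [hyp]; exact hUho.mem_nhds hpUh)
  have hΩ₁e' : Ω₁ =ᶠ[𝓝 y] fun z => Ω ((extChartAt (𝓡 d) p).symm z) := hΩ₁e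
  have hh₁e' : h₁ =ᶠ[𝓝 y] fun z => h ((extChartAt (𝓡 d) p).symm z) := hh₁e
  have hev : ∀ᶠ z in 𝓝 y, z ∈ (extChartAt (𝓡 d) p).target ∧ A₁ z = chartInverseMetric g p z ∧
      Ω₁ z = Ω ((extChartAt (𝓡 d) p).symm z) ∧
      (h₁ z = 0 ↔ (extChartAt (𝓡 d) p).symm z ∈ H) := by
    filter_upwards [hto.mem_nhds hyt, hA₁e, hΩ₁e, hh₁e, hpre] with z h1 h2 h3 h4 h5
    exact ⟨h1, h2, h3, by rw [h4, ← hhH _ h5]⟩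
  obtain ⟨G, hG, hGo, hyG⟩ := eventually_nhds_iff.1 hev
  have hdiff : ∀ {k : M → ℝ} {U : Set M}, IsOpen U → p ∈ U →
      ContMDiffOn (𝓡 d) 𝓘(ℝ, ℝ) ∞ k U →
      MDifferentiableAt (𝓡 d) 𝓘(ℝ, ℝ) k ((extChartAt (𝓡 d) p).symm y) := by
    intro k U hU hpU hk
    rw [hyp]
    exact (hk.contMDiffAt (hU.mem_nhds hpU)).mdifferentiableAt (by simp)
  refine ⟨G, A₁, Ω₁, h₁, hGo, hyG, fun z hz => (hG z hz).1, hA₁, hΩ₁, hh₁,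
    fun z hz => (hG z hz).2.1, fun z hz => (hG z hz).2.2.1, fun z hz => (hG z hz).2.2.2, ?_⟩
  -- Non-tangency supplies some `h'` vanishing on `H` with `dh'(∇Ω) ≠ 0`. Since `dh'` is a multiple
  -- of `dh`, the defining function `h` has the same property.
  have htan := hHtrans p hp.symm
  simp only [IsTangentTo, not_forall] at htan
  obtain ⟨U', h', hU'o, hpU', hh', hv', hne⟩ := htan
  obtain ⟨h'₁, hh'₁, hh'₁e⟩ := exists_contDiff_eq_comp_chart_symm hU'o hpU' hh'
  have hh'₁e' : h'₁ =ᶠ[𝓝 y] fun z => h' ((extChartAt (𝓡 d) p).symm z) := hh'₁e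
  have hpre' : ∀ᶠ z in 𝓝 y, (extChartAt (𝓡 d) p).symm z ∈ U' := by
    have hc : ContinuousAt (extChartAt (𝓡 d) p).symm y := continuousAt_extChartAt_symm p
    exact hc.preimage_mem_nhds (by rw [hyp]; exact hU'o.mem_nhds hpU')
  have hh₁y : h₁ y = 0 := (hG y hyG).2.2.2.2 (by rw [hyp]; exact hp.2)
  have hdh₁ : fderiv ℝ h₁ y ≠ 0 := by
    intro h0
    apply hdh
    rw [hh₁e'.fderiv_eq] at h0
    obtain ⟨e, he⟩ := chartSymmDeriv_isInvertible hyt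
    rw [← hyp]
    ext v
    have h1 := fderiv_comp_chart_symm hyt (hdiff hUho hpUh hh) (e.symm v)
    have h2 : chartSymmDeriv p y (e.symm v) = v := by rw [← he]; exact e.apply_symm_apply v
    rw [h0, h2] at h1
    exact h1.symm
  obtain ⟨c, hc⟩ := exists_fderiv_eq_smul_of_vanishes hh₁ hh₁y hdh₁ isOpen_univ (mem_univ y)
    hh'₁.contDiffOn (by
      filter_upwards [hh'₁e, hpre', hGo.mem_nhds hyG] with z h1 h2 h3 h4
      rw [h1]
      exact hv' _ ⟨h2, (hG z h3).2.2.2.1 h4⟩)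
  intro h0
  apply hne
  have h1 := fderiv_chartInverseMetric hg hyt (hdiff isOpen_univ (mem_univ p)
    hgΩ.smooth.contMDiffOn) (hdiff hU'o hpU' hh')
  rw [← hΩ₁e'.fderiv_eq, ← hh'₁e'.fderiv_eq, ← (hG y hyG).2.1, hc, smul_apply, h0,
    smul_zero, hyp] at h1
  exact h1.symm

/-- Local existence of the gauge near each point of `𝒥 ∩ H`. -/
theorem exists_isLocalGauge (hgΩ : IsConformalManifold g Ω)
    (hlam : ∀ p ∈ scri Ω, lam g Ω p = 0) (hH : IsHypersurface d H)
    (hHtrans : IsTransverseToScri g Ω H) (hω₀ : IsSmoothOnHypersurface d H ω₀)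
    (hω₀ne : ∀ q, ω₀ q ≠ 0) (hp : p ∈ scri Ω ∩ H) :
    ∃ (N : Set M) (w : M → ℝ), p ∈ N ∧ IsLocalGauge g Ω H ω₀ N w := by
  have hg := hgΩ.metric
  obtain ⟨G, A₁, Ω₁, h₁, hGo, hyG, hGt, hA₁, hΩ₁, hh₁, hAe, hΩe, hhe, htr⟩ :=
    exists_chart_data hgΩ hH hHtrans hp
  set y := extChartAt (𝓡 d) p p with hy
  have hyp : (extChartAt (𝓡 d) p).symm y = p := extChartAt_to_inv p
  obtain ⟨UF, F, hUFo, hpUF, hF, hFω⟩ := hω₀ ⟨p, hp.2⟩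
  obtain ⟨F₁, hF₁, hF₁e⟩ := exists_contDiff_eq_comp_chart_symm hUFo hpUF hF
  have hF₁y : F₁ y ≠ 0 := by
    rw [hF₁e.self_of_nhds, ← hy, hyp, hFω ⟨p, hp.2⟩ hpUF]
    exact hω₀ne _
  have hpre : ∀ᶠ z in 𝓝 y, (extChartAt (𝓡 d) p).symm z ∈ UF := by
    have hc : ContinuousAt (extChartAt (𝓡 d) p).symm y := continuousAt_extChartAt_symm p
    exact hc.preimage_mem_nhds (by rw [hyp]; exact hUFo.mem_nhds hpUF)
  obtain ⟨G', hG', hG'o, hyG'⟩ := eventually_nhds_iff.1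
    ((hF₁e.and hpre).and ((hF₁.continuous.continuousAt.eventually_ne hF₁y).and
      (hGo.mem_nhds hyG)))
  have hΩ₁y : Ω₁ y = 0 := by rw [hΩe y hyG, hyp]; exact hp.1
  have hh₁y : h₁ y = 0 := (hhe y hyG).2 (by rw [hyp]; exact hp.2)
  have hΩd : ∀ q, MDifferentiableAt (𝓡 d) 𝓘(ℝ, ℝ) Ω q := fun q =>
    hgΩ.smooth.mdifferentiable (by simp) q
  have hd : ∀ z, Ω₁ z = 0 → fderiv ℝ (fun z => F₁ z * Ω₁ z) z = F₁ z • fderiv ℝ Ω₁ z := by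
    intro z hz
    have h1 := (hF₁.differentiable (by simp) z).hasFDerivAt.mul
      (hΩ₁.differentiable (by simp) z).hasFDerivAt
    refine h1.fderiv.trans ?_
    rw [hz, zero_smul, add_zero]
  -- Using `F₁ Ω₁` in place of `Ω₁` reduces the initial condition to `ρ = 1`. Where `Ω₁ = 0` the
  -- differential is only multiplied by `F₁`, so nullity and transversality persist.
  obtain ⟨U, ρ, hUo, hyU, hρ, hρpos, hρn, hρi⟩ := exists_local_gauge hA₁ (hF₁.mul hΩ₁) hh₁
    (y := y)
    (by
      filter_upwards [hGo.mem_nhds hyG] with z hz α β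
      rw [hAe z hz]
      exact chartInverseMetric_symm hg (hGt hz) α β)
    (by rw [hΩ₁y, mul_zero]) hh₁y
    (by
      change fderiv ℝ h₁ y (A₁ y (fderiv ℝ (fun z => F₁ z * Ω₁ z) y)) ≠ 0
      rw [hd y hΩ₁y, map_smul, map_smul]
      exact mul_ne_zero hF₁y htr)
    (by
      filter_upwards [hG'o.mem_nhds hyG'] with z hz hz0
      have hzG := (hG' z hz).2.2
      have h0 : Ω₁ z = 0 := (mul_eq_zero.1 hz0).resolve_left (hG' z hz).2.1
      change fderiv ℝ (fun z => F₁ z * Ω₁ z) z (A₁ z (fderiv ℝ (fun z => F₁ z * Ω₁ z) z)) = 0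
      rw [hd z h0]
      have h1 := gradNormSq_chart hg (hGt hzG) (hΩd _) (f₁ := Ω₁)
        (by filter_upwards [hGo.mem_nhds hzG] with x hx using hΩe x hx)
      rw [gradNormSq_eq_zero_of_lam hlam (by rw [← hΩe z hzG, h0]), ← hAe z hzG] at h1
      simp only [map_smul, smul_apply, ← h1, smul_zero])
  let N : Set M := (extChartAt (𝓡 d) p).source ∩ extChartAt (𝓡 d) p ⁻¹' (U ∩ G')
  let w : M → ℝ := fun q => ρ (extChartAt (𝓡 d) p q) * F q
  have hNo : IsOpen N := isOpen_chart_preimage p (hUo.inter hG'o)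
  have hNF : ∀ q ∈ N, q ∈ UF := by
    intro q hq
    have := (hG' _ hq.2.2).1.2
    rwa [(extChartAt (𝓡 d) p).left_inv hq.1] at this
  have hFq : ∀ q ∈ N, F₁ (extChartAt (𝓡 d) p q) = F q := by
    intro q hq
    have := (hG' _ hq.2.2).1.1
    rwa [(extChartAt (𝓡 d) p).left_inv hq.1] at this
  have hsm : ContMDiffOn (𝓡 d) 𝓘(ℝ, ℝ) ∞ w N := by
    have h1 : ContMDiffOn (𝓡 d) 𝓘(ℝ, ℝ) ∞ (fun q => ρ (extChartAt (𝓡 d) p q)) N := by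
      refine (contMDiffOn_iff_contDiffOn.2 hρ).comp
        ((contMDiffOn_extChartAt (n := ∞)).mono ?_) fun q hq => hq.2.1
      intro q hq
      rw [← extChartAt_source (𝓡 d)]
      exact hq.1
    exact h1.mul (hF.mono hNF)
  have hne : ∀ q ∈ N, w q ≠ 0 := by
    intro q hq
    refine mul_ne_zero (hρpos _ hq.2.1).ne' ?_
    rw [← hFq q hq]
    exact (hG' _ hq.2.2).2.1
  refine ⟨N, w, ⟨mem_extChartAt_source p, hyU, hyG'⟩, hNo, hsm, hne, ?_, ?_⟩
  · intro q hq
    rw [hg.gradNormSq_rescale_eq_zero_iff (hne q hq)]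
    set z := extChartAt (𝓡 d) p q with hz
    have hqz : (extChartAt (𝓡 d) p).symm z = q := (extChartAt (𝓡 d) p).left_inv hq.1
    have hzG : z ∈ G := (hG' z hq.2.2).2.2
    have h1 := gradNormSq_chart hg (hGt hzG) (f := fun q => w q * Ω q)
      (f₁ := fun z => ρ z * (F₁ z * Ω₁ z))
      (by
        rw [hqz]
        exact ((hsm.contMDiffAt (hNo.mem_nhds hq)).mdifferentiableAt (by simp)).mul (hΩd q))
      (by
        filter_upwards [hUo.mem_nhds hq.2.1, hG'o.mem_nhds hq.2.2] with x hx hx'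
        have hxG := (hG' x hx').2.2
        simp only [w, (extChartAt (𝓡 d) p).right_inv (hGt hxG), (hG' x hx').1.1, hΩe x hxG]
        ring)
    rw [hqz] at h1
    rw [h1, ← hAe z hzG]
    exact hρn z hq.2.1
  · intro q hq
    have hh0 : h₁ (extChartAt (𝓡 d) p q) = 0 := by
      rw [hhe _ (hG' _ hq.2.2).2.2, (extChartAt (𝓡 d) p).left_inv hq.1]
      exact q.2
    simp only [w, hρi _ hq.2.1 hh0, one_mul, hFω q (hNF _ hq)]

/-- Local uniqueness of the gauge near each point of `𝒥 ∩ H`. -/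
theorem exists_isOpen_gauge_unique (hgΩ : IsConformalManifold g Ω) (hH : IsHypersurface d H)
    (hHtrans : IsTransverseToScri g Ω H) (hp : p ∈ scri Ω ∩ H) {N : Set M} {w : M → ℝ}
    (hpN : p ∈ N) (hw : IsLocalGauge g Ω H ω₀ N w) {V : Set M} (hV : IsOpen V) (hpV : p ∈ V) :
    ∃ U : Set M, IsOpen U ∧ p ∈ U ∧ U ⊆ N ∩ V ∧
      ∀ w' : M → ℝ, IsLocalGauge g Ω H ω₀ U w' → EqOn w' w U := by
  have hg := hgΩ.metric
  obtain ⟨G, A₁, Ω₁, h₁, hGo, hyG, hGt, hA₁, hΩ₁, hh₁, hAe, hΩe, hhe, htr⟩ :=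
    exists_chart_data hgΩ hH hHtrans hp
  set y := extChartAt (𝓡 d) p p with hy
  have hyp : (extChartAt (𝓡 d) p).symm y = p := extChartAt_to_inv p
  obtain ⟨w₁, hw₁, hw₁e⟩ := exists_contDiff_eq_comp_chart_symm hw.isOpen hpN hw.smooth
  have hpre : ∀ᶠ z in 𝓝 y, (extChartAt (𝓡 d) p).symm z ∈ N ∩ V := by
    have hc : ContinuousAt (extChartAt (𝓡 d) p).symm y := continuousAt_extChartAt_symm p
    exact hc.preimage_mem_nhds
      (by rw [hyp]; exact inter_mem (hw.isOpen.mem_nhds hpN) (hV.mem_nhds hpV))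
  obtain ⟨G', hG', hG'o, hyG'⟩ := eventually_nhds_iff.1
    ((hw₁e.and hpre).and (hGo.mem_nhds hyG))
  have hw₁ne : ∀ z ∈ G', w₁ z ≠ 0 := by
    intro z hz
    rw [(hG' z hz).1.1]
    exact hw.ne_zero _ (hG' z hz).1.2.1
  have hΩ₁y : Ω₁ y = 0 := by rw [hΩe y hyG, hyp]; exact hp.1
  have hh₁y : h₁ y = 0 := (hhe y hyG).2 (by rw [hyp]; exact hp.2)
  have hΩd : ∀ q, MDifferentiableAt (𝓡 d) 𝓘(ℝ, ℝ) Ω q := fun q =>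
    hgΩ.smooth.mdifferentiable (by simp) q
  -- With the known solution absorbed, `w₁ Ω₁` has null gradient near `y`, and a competitor `w'`
  -- becomes the factor `w' / w₁`, to be shown equal to `1`.
  obtain ⟨U, hUo, hyU, hUG', hU⟩ := exists_nhds_gauge_unique hA₁ (hw₁.mul hΩ₁) hh₁
    (y := y)
    (by
      filter_upwards [hGo.mem_nhds hyG] with z hz α β
      rw [hAe z hz]
      exact chartInverseMetric_symm hg (hGt hz) α β)
    (by rw [hΩ₁y, mul_zero]) hh₁y
    (by
      have h1 := (hw₁.differentiable (by simp) y).hasFDerivAt.mul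
        (hΩ₁.differentiable (by simp) y).hasFDerivAt
      have h2 : fderiv ℝ (fun z => w₁ z * Ω₁ z) y = _ := h1.fderiv
      rw [h2, hΩ₁y, zero_smul, add_zero, map_smul, map_smul]
      exact mul_ne_zero (hw₁ne y hyG') htr)
    (by
      filter_upwards [hG'o.mem_nhds hyG'] with z hz
      have hzG := (hG' z hz).2
      have hzN := (hG' z hz).1.2.1
      have h1 := gradNormSq_chart hg (hGt hzG) (f := fun q => w q * Ω q) (f₁ := fun z => w₁ z * Ω₁ z)
        (((hw.smooth.contMDiffAt (hw.isOpen.mem_nhds hzN)).mdifferentiableAt (by simp)).mul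
          (hΩd _))
        (by
          filter_upwards [hG'o.mem_nhds hz] with x hx
          rw [(hG' x hx).1.1, hΩe x (hG' x hx).2])
      rw [(hg.gradNormSq_rescale_eq_zero_iff (hw.ne_zero _ hzN)).1
        (hw.gradNormSq_eq_zero _ hzN), ← hAe z hzG] at h1
      exact h1.symm)
    (hG'o.mem_nhds hyG')
  let U₀ : Set M := (extChartAt (𝓡 d) p).source ∩ extChartAt (𝓡 d) p ⁻¹' U
  have hsub : U₀ ⊆ N ∩ V := by
    intro q hq
    have := (hG' _ (hUG' hq.2)).1.2
    rwa [(extChartAt (𝓡 d) p).left_inv hq.1] at this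
  refine ⟨U₀, isOpen_chart_preimage p hUo, ⟨mem_extChartAt_source p, hyU⟩, hsub, fun w' hw' => ?_⟩
  have hUU₀ : ∀ z ∈ U, (extChartAt (𝓡 d) p).symm z ∈ U₀ := by
    intro z hz
    have hzt := hGt (hG' z (hUG' hz)).2
    refine ⟨(extChartAt (𝓡 d) p).map_target hzt, ?_⟩
    rw [mem_preimage, (extChartAt (𝓡 d) p).right_inv hzt]
    exact hz
  have hw'c : ContDiffOn ℝ ∞ (fun z => w' ((extChartAt (𝓡 d) p).symm z)) U := by
    rw [← contMDiffOn_iff_contDiffOn]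
    exact hw'.smooth.comp ((contMDiffOn_extChartAt_symm p).mono
      fun z hz => hGt (hG' z (hUG' hz)).2) hUU₀
  have hprod : ∀ z ∈ U, w' ((extChartAt (𝓡 d) p).symm z) / w₁ z * (w₁ z * Ω₁ z) =
      w' ((extChartAt (𝓡 d) p).symm z) * Ω ((extChartAt (𝓡 d) p).symm z) := by
    intro z hz
    have h1 := hw₁ne z (hUG' hz)
    rw [← hΩe z (hG' z (hUG' hz)).2]
    field_simp
  have hone := hU (fun z => w' ((extChartAt (𝓡 d) p).symm z) / w₁ z)
    (hw'c.div hw₁.contDiffOn fun z hz => hw₁ne z (hUG' hz))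
    (fun z hz => div_ne_zero (hw'.ne_zero _ (hUU₀ z hz)) (hw₁ne z (hUG' hz)))
    (by
      intro z hz
      have hzG := (hG' z (hUG' hz)).2
      have hzU₀ := hUU₀ z hz
      have h1 := gradNormSq_chart hg (hGt hzG) (f := fun q => w' q * Ω q)
        (f₁ := fun z => w' ((extChartAt (𝓡 d) p).symm z) / w₁ z * (w₁ z * Ω₁ z))
        (((hw'.smooth.contMDiffAt (hw'.isOpen.mem_nhds hzU₀)).mdifferentiableAt (by simp)).mul
          (hΩd _))
        (by filter_upwards [hUo.mem_nhds hz] with x hx using hprod x hx)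
      rw [(hg.gradNormSq_rescale_eq_zero_iff (hw'.ne_zero _ hzU₀)).1
        (hw'.gradNormSq_eq_zero _ hzU₀), ← hAe z hzG] at h1
      exact h1.symm)
    (by
      intro z hz hz0
      have hzG := (hG' z (hUG' hz)).2
      have hzH := (hhe z hzG).1 hz0
      have h1 := hw'.initial ⟨_, hzH⟩ (hUU₀ z hz)
      have h2 := hw.initial ⟨_, hzH⟩ (hsub (hUU₀ z hz)).1
      rw [hprod z hz, (hG' z (hUG' hz)).1.1, hΩe z hzG, h2]
      exact h1)
  intro q hq
  have h1 := hone _ hq.2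
  rw [div_eq_one_iff_eq (hw₁ne _ (hUG' hq.2)), (hG' _ (hUG' hq.2)).1.1,
    (extChartAt (𝓡 d) p).left_inv hq.1] at h1
  exact h1

end LocalTheory

/-! ### Gluing -/

/-- Local sections defined near the points of a subset of a metric space, each of them unique on
arbitrarily small neighbourhoods, agree on a suitable family of neighbourhoods. -/
theorem exists_compatible_nhds {X Y : Type*} [MetricSpace X] {A : Set X}
    {S : Set X → (X → Y) → Prop}
    (hmono : ∀ {U V : Set X} {f : X → Y}, S U f → IsOpen V → V ⊆ U → S V f)
    (hopen : ∀ {U : Set X} {f : X → Y}, S U f → IsOpen U)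
    (hex : ∀ p ∈ A, ∃ (N : Set X) (f : X → Y), p ∈ N ∧ S N f)
    (huniq : ∀ p ∈ A, ∀ (N : Set X) (f : X → Y), p ∈ N → S N f → ∀ V, IsOpen V → p ∈ V →
      ∃ U, IsOpen U ∧ p ∈ U ∧ U ⊆ N ∩ V ∧ ∀ f', S U f' → EqOn f' f U) :
    ∃ (U : A → Set X) (f : A → X → Y), (∀ p, (p : X) ∈ U p) ∧ (∀ p, S (U p) (f p)) ∧
      (∀ p f', S (U p) f' → EqOn f' (f p) (U p)) ∧
      ∀ p q, EqOn (f p) (f q) (U p ∩ U q) := by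
  choose N f hpN hS using fun p : A => hex p p.2
  have hr : ∀ p : A, ∃ r > 0, Metric.ball (p : X) (3 * r) ⊆ N p := by
    intro p
    obtain ⟨ε, hε, h⟩ := Metric.isOpen_iff.1 (hopen (hS p)) p (hpN p)
    exact ⟨ε / 3, by positivity, by rwa [mul_div_cancel₀ ε three_ne_zero]⟩
  choose r hr0 hrN using hr
  choose U hUo hpU hUsub hU using fun p : A => huniq p p.2 (N p) (f p) (hpN p) (hS p)
    (Metric.ball (p : X) (r p)) Metric.isOpen_ball (Metric.mem_ball_self (hr0 p))
  -- If `U q` meets `U p` and `r q ≤ r p`, then `U q` lies within `r q + r q + r p ≤ 3 r p` of `p`,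
  -- hence in `N p`. So `f p` is a solution on all of `U q`, and uniqueness there applies without
  -- any condition on `U p ∩ U q`.
  have key : ∀ p q : A, r q ≤ r p → EqOn (f p) (f q) (U p ∩ U q) := by
    intro p q hqp x hx
    have hsub : U q ⊆ N p := by
      intro z hz
      apply hrN p
      have h1 : dist z q < r q := (hUsub q hz).2
      have h2 : dist x q < r q := (hUsub q hx.2).2
      have h3 : dist x p < r p := (hUsub p hx.1).2
      have h4 := dist_triangle4 z q x p
      rw [dist_comm (q : X) x] at h4
      rw [Metric.mem_ball]
      linarith
    exact hU q (f p) (hmono (hS p) (hUo q) hsub) hx.2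
  refine ⟨U, f, hpU, fun p => hmono (hS p) (hUo p) fun x hx => (hUsub p hx).1, hU,
    fun p q => ?_⟩
  rcases le_total (r q) (r p) with h | h
  · exact key p q h
  · intro x hx
    exact (key q p h hx.symm).symm

end ConfGauge

theorem mainTheorem6 (d : ℕ) (hd : 3 ≤ d) {M : Type*} [TopologicalSpace M] [T2Space M]
    [SecondCountableTopology M] [ChartedSpace (ConfGauge.Model d) M] [IsManifold (𝓡 d) ∞ M]
    (g : ConfGauge.BilinField d M) (Ω : M → ℝ)
    (hgΩ : ConfGauge.IsConformalManifold g Ω)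
    (hlam : ∀ p ∈ ConfGauge.scri Ω, ConfGauge.lam g Ω p = 0)
    (H : Set M) (hH : ConfGauge.IsHypersurface d H)
    (hHtrans : ConfGauge.IsTransverseToScri g Ω H)
    (ω₀ : H → ℝ) (hω₀ : ConfGauge.IsSmoothOnHypersurface d H ω₀) (hω₀ne : ∀ q, ω₀ q ≠ 0) :
    ∃ (U : Set M) (w : M → ℝ),
      ConfGauge.IsGauge g Ω H ω₀ U w ∧
      (∀ w' : M → ℝ, ConfGauge.IsGauge g Ω H ω₀ U w' → Set.EqOn w' w U) ∧
      (∀ (U' : Set M) (w' : M → ℝ), ConfGauge.IsGauge g Ω H ω₀ U' w' →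
        ∃ V : Set M, IsOpen V ∧ ConfGauge.scri Ω ∩ H ⊆ V ∧ V ⊆ U ∩ U' ∧ Set.EqOn w' w V) := by
  classical
  have : LocallyCompactSpace M := ChartedSpace.locallyCompactSpace (ConfGauge.Model d) M
  -- Any compatible metric will do: it serves only to compare the sizes of neighbourhoods in the
  -- gluing.
  have : TopologicalSpace.MetrizableSpace M := Manifold.metrizableSpace (𝓡 d) M
  let _ := TopologicalSpace.metrizableSpaceMetric M
  obtain ⟨U, w, hpU, hw, huniq, hcomp⟩ := ConfGauge.exists_compatible_nhds
    (A := ConfGauge.scri Ω ∩ H) (S := ConfGauge.IsLocalGauge g Ω H ω₀)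
    (fun h hV hVU => h.mono hV hVU) (fun h => h.isOpen)
    (fun p hp => ConfGauge.exists_isLocalGauge hgΩ hlam hH hHtrans hω₀ hω₀ne hp)
    (fun p hp N f hpN hf V hV hpV =>
      ConfGauge.exists_isOpen_gauge_unique hgΩ hH hHtrans hp hpN hf hV hpV)
  -- By `hcomp` the choice of `p` is immaterial; the value `1` off the union plays no role.
  let W : M → ℝ := fun x => if h : ∃ p, x ∈ U p then w h.choose x else 1
  have hW : ∀ p, Set.EqOn W (w p) (U p) := by
    intro p x hx
    have h : ∃ p, x ∈ U p := ⟨p, hx⟩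
    simp only [W, dif_pos h]
    exact hcomp _ _ ⟨h.choose_spec, hx⟩
  have hWl : ∀ p, ConfGauge.IsLocalGauge g Ω H ω₀ (U p) W := fun p => (hw p).congr (hW p)
  have hmem : ∀ {x : M}, x ∈ ⋃ p, U p ↔ ∃ p, x ∈ U p := Set.mem_iUnion
  refine ⟨⋃ p, U p, W, ⟨isOpen_iUnion fun p => (hw p).isOpen,
    fun p hp => hmem.2 ⟨⟨p, hp⟩, hpU ⟨p, hp⟩⟩, fun x hx => ?_, fun x hx => ?_, fun x hx => ?_,
    fun q hq => ?_⟩, fun w' hw' x hx => ?_, fun U' w' hw' => ?_⟩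
  · obtain ⟨p, hp⟩ := hmem.1 hx
    exact ((hWl p).smooth.contMDiffAt ((hWl p).isOpen.mem_nhds hp)).contMDiffWithinAt
  · obtain ⟨p, hp⟩ := hmem.1 hx
    exact (hWl p).ne_zero x hp
  · obtain ⟨p, hp⟩ := hmem.1 hx
    exact (hWl p).gradNormSq_eq_zero x hp
  · obtain ⟨p, hp⟩ := hmem.1 hq
    exact (hWl p).initial q hp
  · obtain ⟨p, hp⟩ := hmem.1 hx
    rw [hW p hp]
    exact huniq p w' (hw'.isLocalGauge.mono (hw p).isOpen (Set.subset_iUnion U p)) hp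
  -- On `U p ∩ U'` uniqueness may fail, so smaller uniqueness neighbourhoods inside it are used.
  · choose V hVo hpV hVsub hV using fun p : ↥(ConfGauge.scri Ω ∩ H) =>
      ConfGauge.exists_isOpen_gauge_unique hgΩ hH hHtrans p.2 (hpU p) (hw p) hw'.isOpen
        (hw'.subset p.2)
    refine ⟨⋃ p, V p, isOpen_iUnion hVo, fun p hp => Set.mem_iUnion.2 ⟨⟨p, hp⟩, hpV ⟨p, hp⟩⟩,
      Set.iUnion_subset fun p x hx => ⟨hmem.2 ⟨p, (hVsub p hx).1⟩, (hVsub p hx).2⟩,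
      fun x hx => ?_⟩
    obtain ⟨p, hp⟩ := Set.mem_iUnion.1 hx
    rw [hV p w' (hw'.isLocalGauge.mono (hVo p) fun x hx => (hVsub p hx).2) hp,
      hW p (hVsub p hp).1]
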